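/- Let $\Gamma$ be a compact metric graph: finitely many vertices, finitely many and at least one edge, each edge $e$ identified with an interval $[0,\ell_e]$, $0<\ell_e<\infty$ (loops and multiple edges are allowed, and $\Gamma$ need not be connected). Let $L^2(\Gamma)=\bigoplus_e L^2(0,\ell_e)$; let $H^1(\Gamma)$ be the space of functions on $\Gamma$ that are continuous on $\Gamma$ and in $H^1(0,\ell_e)$ on every edge; let $\widetilde H^2_C(\Gamma)$ be the space of functions that are continuous on $\Gamma$ and in $H^2(0,\ell_e)$ on every edge; and let $H^{3/2}(\Gamma)=(H^1(\Gamma),\widetilde H^2_C(\Gamma))_{1/2}$ be the real interpolation space, that is, the space of all $u$ with $\int_0^\infty t^{-2}K(t,u)^2\,dt<\infty$, where $K(t,u)^2=\inf\{\|v\|_{H^1}^2+t^2\|w\|_{H^2}^2 : u=v+w\}$ over $v\in H^1(\Gamma)$, $w\in\widetilde H^2_C(\Gamma)$. Fix a constant $\kappa>0$. For $u\in H^{3/2}(\Gamma)$ let $\mathcal L_u p=\kappa^2p-(e^{u}p')'$ be the operator in $L^2(\Gamma)$ whose domain consists of all $p\in H^1(\Gamma)$ such that the flux $e^{u}p'$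 is in $H^1(0,\ell_e)$ on every edge and, at every vertex, the sum over all incident edge ends of the outward-directed fluxes $e^{u_e}\partial_e p$ is $0$ (standard Kirchhoff conditions). Then for every $u\in H^{3/2}(\Gamma)$ the eigenvalues of $\mathcal L_u$, repeated according to multiplicity, can be listed in non-decreasing order as an infinite sequence $\lambda_1\le\lambda_2\le\cdots$. Moreover, for every real $s\ge 0$ there is a constant $C>0$, which depends only on $\Gamma$, $\kappa$ and $s$, such that for all $u_1,u_2\in H^{3/2}(\Gamma)$, with $\{\lambda_j^{(i)}\}_{j\ge1}$ the sequence of eigenvalues of $\mathcal L_{u_i}$ so arranged ($i=1,2$), and for all $j\ge 1$, $$\bigl|(\lambda_j^{(1)})^{-s}-(\lambda_j^{(2)})^{-s}\bigr|\le C\exp\Bigl((s+2)\max\{\|u_1\|_{L^\infty(\Gamma)},\|u_2\|_{L^\infty(\Gamma)}\}\Bigr)\,\|u_1-u_2\|_{L^\infty(\Gamma)}.$$ -/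

import Mathlib

open MeasureTheory

/-- A metric graph with vertex set `V` and edge set `E`: each edge `e` is oriented from `src e` to
`tgt e` and identified with the interval `[0, len e]`. Loops and multiple edges are allowed. The
graph is compact when `V` and `E` are finite. -/
structure MetricGraph (V E : Type*) where
  src : E → V
  tgt : E → V
  len : E → ℝ
  len_pos : ∀ e, 0 < len e

namespace MetricGraph

/-- Lebesgue measure on the interval `(0, ℓ]`. -/
noncomputable abbrev edgeMeasure (ℓ : ℝ) : Measure ℝ := volume.restrict (Set.Ioc 0 ℓ)

/-- `f ∈ H¹(0, ℓ)` with weak derivative `g ∈ L²(0, ℓ)`, and `F` is, on `[0, ℓ]`, the (absolutely)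
continuous representative of `f`. -/
def IsH1Rep (ℓ : ℝ) (F : ℝ → ℝ) (f g : Lp ℝ 2 (edgeMeasure ℓ)) : Prop :=
  (∀ᵐ t ∂(edgeMeasure ℓ), F t = f t) ∧
    ∀ t ∈ Set.Icc (0 : ℝ) ℓ, F t = F 0 + ∫ x in (0 : ℝ)..t, g x

theorem intervalIntegrable_of_mem {ℓ t : ℝ} (g : Lp ℝ 2 (edgeMeasure ℓ))
    (ht : t ∈ Set.Icc (0 : ℝ) ℓ) : IntervalIntegrable (fun x => g x) volume 0 t := by
  rw [intervalIntegrable_iff_integrableOn_Ioc_of_le ht.1]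
  have h : IntegrableOn (fun x => g x) (Set.Ioc 0 ℓ) volume := (Lp.memLp g).integrable (by norm_num)
  exact h.mono_set (Set.Ioc_subset_Ioc_right ht.2)

theorem ae_restrict_of_mem {ℓ t : ℝ} {P : ℝ → Prop} (ht : t ∈ Set.Icc (0 : ℝ) ℓ)
    (h : ∀ᵐ x ∂(edgeMeasure ℓ), P x) : ∀ᵐ x, x ∈ Set.uIoc 0 t → P x := by
  have h' := (ae_restrict_iff' measurableSet_Ioc).1 h
  filter_upwards [h'] with x hx hxt
  rw [Set.uIoc_of_le ht.1] at hxt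
  exact hx ⟨hxt.1, hxt.2.trans ht.2⟩

theorem IsH1Rep.add {ℓ : ℝ} {F₁ F₂ : ℝ → ℝ} {f₁ f₂ g₁ g₂ : Lp ℝ 2 (edgeMeasure ℓ)}
    (h₁ : IsH1Rep ℓ F₁ f₁ g₁) (h₂ : IsH1Rep ℓ F₂ f₂ g₂) :
    IsH1Rep ℓ (fun t => F₁ t + F₂ t) (f₁ + f₂) (g₁ + g₂) := by
  refine ⟨?_, fun t ht => ?_⟩
  · filter_upwards [h₁.1, h₂.1, Lp.coeFn_add f₁ f₂] with t a b c
    rw [c, Pi.add_apply, a, b]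
  · have e : ∫ x in (0 : ℝ)..t, (g₁ + g₂ : Lp ℝ 2 (edgeMeasure ℓ)) x
        = ∫ x in (0 : ℝ)..t, (g₁ x + g₂ x) :=
      intervalIntegral.integral_congr_ae (ae_restrict_of_mem ht (Lp.coeFn_add g₁ g₂))
    rw [e, intervalIntegral.integral_add (intervalIntegrable_of_mem g₁ ht)
      (intervalIntegrable_of_mem g₂ ht)]
    simp only [h₁.2 t ht, h₂.2 t ht]
    ring

theorem IsH1Rep.smul {ℓ : ℝ} {F : ℝ → ℝ} {f g : Lp ℝ 2 (edgeMeasure ℓ)} (c : ℝ)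
    (h : IsH1Rep ℓ F f g) : IsH1Rep ℓ (fun t => c * F t) (c • f) (c • g) := by
  refine ⟨?_, fun t ht => ?_⟩
  · filter_upwards [h.1, Lp.coeFn_smul c f] with t a b
    rw [b, Pi.smul_apply, a, smul_eq_mul]
  · have e : ∫ x in (0 : ℝ)..t, (c • g : Lp ℝ 2 (edgeMeasure ℓ)) x
        = ∫ x in (0 : ℝ)..t, c * g x :=
      intervalIntegral.integral_congr_ae (ae_restrict_of_mem ht (Lp.coeFn_smul c g))
    rw [e, intervalIntegral.integral_const_mul]
    simp only [h.2 t ht]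
    ring

theorem IsH1Rep.zero (ℓ : ℝ) : IsH1Rep ℓ (fun _ => 0) 0 0 := by
  refine ⟨?_, fun t ht => ?_⟩
  · filter_upwards [Lp.coeFn_zero ℝ 2 (edgeMeasure ℓ)] with t a
    rw [a, Pi.zero_apply]
  · have e : ∫ x in (0 : ℝ)..t, (0 : Lp ℝ 2 (edgeMeasure ℓ)) x = ∫ x in (0 : ℝ)..t, (0 : ℝ) :=
      intervalIntegral.integral_congr_ae
        (ae_restrict_of_mem ht (Lp.coeFn_zero ℝ 2 (edgeMeasure ℓ)))
    rw [e]
    simp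

variable {V E : Type*} [Fintype V] [Fintype E] (Γ : MetricGraph V E)

/-- The Hilbert space `L²(Γ) = ⨁ₑ L²(e)`. -/
noncomputable abbrev L2 : Type _ := PiLp 2 fun e : E => Lp ℝ 2 (edgeMeasure (Γ.len e))

/-- The norm of `L^∞(Γ)`, the essential supremum of `|f|` over all edges. -/
noncomputable def normLinfty (f : Γ.L2) : ℝ :=
  (⨆ e, eLpNorm (f e) ⊤ (edgeMeasure (Γ.len e))).toReal

/-- A family of functions on the edges takes one common value at each vertex. -/
def VertexContinuous (F : E → ℝ → ℝ) : Prop :=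
  ∃ val : V → ℝ, ∀ e, F e 0 = val (Γ.src e) ∧ F e (Γ.len e) = val (Γ.tgt e)

open Classical in
/-- The standard Kirchhoff condition for a family of fluxes `Q e = aₑ pₑ'`: at each vertex the sum
of the outward-directed fluxes over the incident edge ends vanishes (a loop has two ends). -/
def Kirchhoff (Q : E → ℝ → ℝ) : Prop :=
  ∀ v : V, (∑ e with Γ.src e = v, Q e 0) + (∑ e with Γ.tgt e = v, -Q e (Γ.len e)) = 0

/-- `p ∈ H¹(Γ)` (edgewise `H¹` and continuous on `Γ`), with edgewise weak derivative `dp`. -/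
def IsH1 (p dp : Γ.L2) : Prop :=
  ∃ P : E → ℝ → ℝ, (∀ e, IsH1Rep (Γ.len e) (P e) (p e) (dp e)) ∧ Γ.VertexContinuous P

/-- `p ∈ ⨁ₑ H²(e) ∩ C(Γ)`, with first and second edgewise weak derivatives `dp` and `ddp`. -/
def IsH2C (p dp ddp : Γ.L2) : Prop :=
  Γ.IsH1 p dp ∧ ∀ e, ∃ G : ℝ → ℝ, IsH1Rep (Γ.len e) G (dp e) (ddp e)

/-- The square of the `K`-functional of the pair `H¹(Γ) ⊇ ⨁ₑ H²(e) ∩ C(Γ)`: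
`K(t, u)² = inf { ‖v‖²_{H¹} + t² ‖w‖²_{H²} : u = v + w }`. -/
noncomputable def kFunctionalSq (t : ℝ) (u : Γ.L2) : ENNReal :=
  sInf {k | ∃ v dv w dw ddw : Γ.L2, u = v + w ∧ Γ.IsH1 v dv ∧ Γ.IsH2C w dw ddw ∧
    k = ENNReal.ofReal
      ((‖v‖ ^ 2 + ‖dv‖ ^ 2) + t ^ 2 * (‖w‖ ^ 2 + ‖dw‖ ^ 2 + ‖ddw‖ ^ 2))}

/-- Membership in `H^s(Γ)`, `1 < s < 2`, the real interpolation space of order `θ = s - 1` between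
`H¹(Γ)` and `⨁ₑ H²(e) ∩ C(Γ)` by the `K`-method: `∫₀^∞ (t ^ (-θ) K(t, u))² dt / t < ∞`. -/
def MemHs (s : ℝ) (u : Γ.L2) : Prop :=
  ∫⁻ t in Set.Ioi (0 : ℝ), ENNReal.ofReal (t ^ (-2 * (s - 1) - 1)) * Γ.kFunctionalSq t u < ⊤

/-- The graph of the operator `L_u p = κ² p - (e^u p')'` in `L²(Γ)` with standard Kirchhoff vertex
conditions: `p ∈ H¹(Γ)`, the flux `q = e^u p'` is edgewise in `H¹` and satisfies the Kirchhoff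
condition, and `L_u p = κ² p - q'`. -/
noncomputable def ellipticGraph (κ : ℝ) (u : Γ.L2) : Submodule ℝ (Γ.L2 × Γ.L2) where
  carrier := {pf | ∃ (dp q dq : Γ.L2) (P Q : E → ℝ → ℝ),
    (∀ e, IsH1Rep (Γ.len e) (P e) (pf.1 e) (dp e)) ∧ Γ.VertexContinuous P ∧
    (∀ e, ∀ᵐ t ∂(edgeMeasure (Γ.len e)), q e t = Real.exp (u e t) * dp e t) ∧
    (∀ e, IsH1Rep (Γ.len e) (Q e) (q e) (dq e)) ∧ Γ.Kirchhoff Q ∧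
    pf.2 = κ ^ 2 • pf.1 - dq}
  add_mem' := by
    rintro ⟨p, f⟩ ⟨p', f'⟩ ⟨dp, q, dq, P, Q, hP, ⟨val, hv⟩, hq, hQ, hK, hf⟩
      ⟨dp', q', dq', P', Q', hP', ⟨val', hv'⟩, hq', hQ', hK', hf'⟩
    refine ⟨dp + dp', q + q', dq + dq', fun e t => P e t + P' e t, fun e t => Q e t + Q' e t,
      fun e => (hP e).add (hP' e), ⟨fun v => val v + val' v, fun e => ?_⟩, fun e => ?_,
      fun e => (hQ e).add (hQ' e), fun v => ?_, ?_⟩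
    · exact ⟨by simp only [(hv e).1, (hv' e).1], by simp only [(hv e).2, (hv' e).2]⟩
    · filter_upwards [hq e, hq' e, Lp.coeFn_add (q e) (q' e), Lp.coeFn_add (dp e) (dp' e)]
        with t a b c d
      rw [PiLp.add_apply, PiLp.add_apply, c, d, Pi.add_apply, Pi.add_apply, a, b]
      ring
    · have h1 := hK v
      have h2 := hK' v
      simp only [neg_add, Finset.sum_add_distrib]
      linarith
    · simp only at hf hf'
      simp only [hf, hf', smul_add, Prod.mk_add_mk]
      abel
  zero_mem' := by
    refine ⟨0, 0, 0, fun _ _ => 0, fun _ _ => 0, fun e => IsH1Rep.zero _,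
      ⟨fun _ => 0, fun e => ⟨rfl, rfl⟩⟩, fun e => ?_, fun e => IsH1Rep.zero _, fun v => by simp,
      by simp⟩
    filter_upwards [Lp.coeFn_zero ℝ 2 (edgeMeasure (Γ.len e))] with t a
    rw [PiLp.zero_apply, a]
    simp
  smul_mem' := by
    rintro c ⟨p, f⟩ ⟨dp, q, dq, P, Q, hP, ⟨val, hv⟩, hq, hQ, hK, hf⟩
    refine ⟨c • dp, c • q, c • dq, fun e t => c * P e t, fun e t => c * Q e t,
      fun e => (hP e).smul c, ⟨fun v => c * val v, fun e => ?_⟩, fun e => ?_,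
      fun e => (hQ e).smul c, fun v => ?_, ?_⟩
    · exact ⟨by simp only [(hv e).1], by simp only [(hv e).2]⟩
    · filter_upwards [hq e, Lp.coeFn_smul c (q e), Lp.coeFn_smul c (dp e)] with t a b d
      rw [PiLp.smul_apply, PiLp.smul_apply, b, d, Pi.smul_apply, Pi.smul_apply, a, smul_eq_mul,
        smul_eq_mul]
      ring
    · have h1 := hK v
      simp only [← mul_neg, ← Finset.mul_sum]
      rw [← mul_add, h1, mul_zero]
    · simp only at hf
      simp only [Prod.smul_mk, hf, smul_sub, smul_comm c (κ ^ 2) p]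

/-- The eigenspace `{p ∈ D(L_u) : L_u p = μ p}`. -/
noncomputable def eigenspace (κ : ℝ) (u : Γ.L2) (μ : ℝ) : Submodule ℝ Γ.L2 :=
  (Γ.ellipticGraph κ u).comap (LinearMap.id.prod (μ • LinearMap.id))

/-- `lam` lists all eigenvalues of `L_u` in non-decreasing order, each one repeated according to its
multiplicity (indices start at `0`). -/
def IsEigenvalueSeq (κ : ℝ) (u : Γ.L2) (lam : ℕ → ℝ) : Prop :=
  Monotone lam ∧
    ∀ μ : ℝ, {j | lam j = μ}.encard = Cardinal.toENat (Module.rank ℝ (Γ.eigenspace κ u μ))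

end MetricGraph

/-! The operator `L_u` is the inverse of the solution operator `T_u` of the form `a_u(p, v) = κ² ⟪p,
v⟫ + ⟪e^u p', v'⟫` on `H¹(Γ)` (`mem_ellipticGraph_iff`). For bounded `u` this form is symmetric and
coercive, so `T_u` is bounded, symmetric and nonnegative. It is compact because `H¹` embeds
compactly in `L²`, and injective. The spectral theorem therefore applies: the solutions of `p = μ
T_u p` are the eigenfunctions, their spaces are finite dimensional, and only finitely many `μ` lie
below any bound. As `L²(Γ)` is infinite dimensional, the eigenvalues form an infinite sequence
(`exists_isListing`).

For the estimate put `δ = ‖u₁ - u₂‖_∞`. Pointwise `e^{u₁} ≤ e^δ e^{u₂}`, hence `a_{u₁} ≤ e^δ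
a_{u₂}`. Inversion reverses this order (`inner_solutionOp_le`), and a min-max dimension count
(`le_of_quadraticForm_le`) gives `λ_j⁽¹⁾ ≤ e^δ λ_j⁽²⁾`, and likewise with the indices exchanged. All
eigenvalues are at least `κ²`, so `1 - e^{-sδ} ≤ sδ` turns the ratio bound into a difference of at
most `κ^{-2s} s δ`.

This is stronger than required: the exponential factor is used only through being at least `1`.
Membership in `H^{3/2}(Γ)` is used only to know that `u` is bounded (`MemHs.memLp_top`). -/

/-! ### Enumeration of a discrete order -/

/-- An infinite linear order with finite initial segments is order isomorphic to `ℕ`. -/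
theorem nonempty_orderIso_nat_of_finite_Iic (I : Type*) [LinearOrder I] [Infinite I]
    (h : ∀ x : I, (Set.Iic x).Finite) : Nonempty (ℕ ≃o I) := by
  classical
  obtain ⟨x₀⟩ := (inferInstance : Nonempty I)
  obtain ⟨m, hm, hmin⟩ := (h x₀).exists_minimal ⟨x₀, le_refl x₀⟩
  have hbot : ∀ x, m ≤ x := fun x => by
    by_contra hx
    have hx' : x ≤ m := (not_le.1 hx).le
    exact hx (hmin (hx'.trans hm) hx')
  let : OrderBot I := { bot := m, bot_le := hbot }
  have : NoMaxOrder I := ⟨fun a => by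
    by_contra hc
    push Not at hc
    have : (Set.univ : Set I).Finite := (h a).subset fun x _ => hc x
    exact Set.infinite_univ this⟩
  let : LocallyFiniteOrder I :=
    LocallyFiniteOrder.ofFiniteIcc fun a b => (h b).subset fun x hx => hx.2
  let : SuccOrder I := LinearLocallyFiniteOrder.succOrder I
  let : PredOrder I := LinearLocallyFiniteOrder.predOrder I
  exact ⟨(orderIsoNatOfLinearSuccPredArch (ι := I)).symm⟩

/-! ### Spectral theory of compact symmetric operators, in terms of reciprocal eigenvalues -/

namespace CompactSpectrum

variable {H : Type*} [NormedAddCommGroup H] [InnerProductSpace ℝ H]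

/-- The solutions of `p = μ T p`. -/
def invEigenspace (T : H →L[ℝ] H) (μ : ℝ) : Submodule ℝ H :=
  LinearMap.ker (LinearMap.id - μ • (T : H →ₗ[ℝ] H))

theorem mem_invEigenspace {T : H →L[ℝ] H} {μ : ℝ} {p : H} :
    p ∈ invEigenspace T μ ↔ p = μ • T p := by
  simp [invEigenspace, sub_eq_zero]

/-- `lam` lists the values `μ` with `invEigenspace T μ ≠ ⊥` in non-decreasing order, repeated
according to the dimension of that space. -/
def IsListing (T : H →L[ℝ] H) (lam : ℕ → ℝ) : Prop :=
  Monotone lam ∧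
    ∀ μ : ℝ, {j | lam j = μ}.encard = Cardinal.toENat (Module.rank ℝ (invEigenspace T μ))

/-- The value `μ = 0` must be excluded: there the left side is trivial, while `0⁻¹ = 0` makes the
right side the kernel of `T`. -/
theorem invEigenspace_eq_eigenspace (T : H →L[ℝ] H) {μ : ℝ} (hμ : μ ≠ 0) :
    invEigenspace T μ = Module.End.eigenspace (T : Module.End ℝ H) μ⁻¹ := by
  ext p
  rw [mem_invEigenspace, Module.End.mem_eigenspace_iff]
  constructor
  · intro h
    conv_rhs => rw [h]
    rw [inv_smul_smul₀ hμ]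
    rfl
  · intro h
    have h' : T p = μ⁻¹ • p := h
    rw [h', smul_inv_smul₀ hμ]

theorem finiteDimensional_invEigenspace [CompleteSpace H] {T : H →L[ℝ] H} (hT : IsCompactOperator T) (μ : ℝ) :
    FiniteDimensional ℝ (invEigenspace T μ) := by
  rcases eq_or_ne μ 0 with rfl | hμ
  · have : invEigenspace T 0 = ⊥ := by
      rw [eq_bot_iff]
      intro p hp
      rw [mem_invEigenspace, zero_smul] at hp
      simpa using hp
    rw [this]
    infer_instance
  · rw [invEigenspace_eq_eigenspace T hμ]
    exact ContinuousLinearMap.finite_dimensional_eigenspace hT _ (inv_ne_zero hμ)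

theorem toENat_rank_invEigenspace [CompleteSpace H] {T : H →L[ℝ] H} (hT : IsCompactOperator T) (μ : ℝ) :
    Cardinal.toENat (Module.rank ℝ (invEigenspace T μ)) =
      (Module.finrank ℝ (invEigenspace T μ) : ℕ∞) := by
  have := finiteDimensional_invEigenspace hT μ
  rw [← Module.finrank_eq_rank, Cardinal.toENat_nat]

theorem inner_eq_zero_of_mem_invEigenspace {T : H →L[ℝ] H} (hs : T.IsSymmetric)
    {μ ν : ℝ} (hμν : μ ≠ ν) {p q : H} (hp : p ∈ invEigenspace T μ) (hq : q ∈ invEigenspace T ν) :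
    inner ℝ p q = 0 := by
  rw [mem_invEigenspace] at hp hq
  have h1 : inner ℝ p q = μ * inner ℝ (T p) q := by
    conv_lhs => rw [hp, real_inner_smul_left]
  have h2 : inner ℝ p q = ν * inner ℝ (T p) q := by
    conv_lhs => rw [hq, real_inner_smul_right]
    rw [show inner ℝ p (T q) = inner ℝ (T p) q from (hs p q).symm]
  have h3 : (μ - ν) * inner ℝ (T p) q = 0 := by linarith
  rcases mul_eq_zero.1 h3 with h | h
  · exact absurd (sub_eq_zero.1 h) hμν
  · rw [h1, h, mul_zero]

/-- By the spectral theorem the eigenspaces of `T` have trivial common orthogonal complement. The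
kernel, the one eigenspace that no `μ` accounts for, vanishes by injectivity. -/
theorem eq_zero_of_forall_invEigenspace_inner_eq_zero [CompleteSpace H] {T : H →L[ℝ] H} (hT : IsCompactOperator T)
    (hs : T.IsSymmetric) (hinj : ∀ f, T f = 0 → f = 0) {f : H}
    (hf : ∀ μ, ∀ p ∈ invEigenspace T μ, inner ℝ p f = 0) : f = 0 := by
  have h := ContinuousLinearMap.orthogonalComplement_iSup_eigenspaces_eq_bot hT hs
  rw [← Submodule.mem_bot ℝ, ← h, ← Submodule.iInf_orthogonal, Submodule.mem_iInf]
  intro ν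
  rw [Submodule.mem_orthogonal]
  intro p hp
  rcases eq_or_ne ν 0 with rfl | hν
  · have : T p = (0 : ℝ) • p := Module.End.mem_eigenspace_iff.1 hp
    rw [zero_smul] at this
    rw [hinj p this, inner_zero_left]
  · refine hf ν⁻¹ p ?_
    rw [invEigenspace_eq_eigenspace T (inv_ne_zero hν), inv_inv]
    exact hp

/-- The indices `j` with `lam j = μ` are as many as the dimension of the space at `μ`, so they can
index an orthonormal basis of it. Glued over all `μ`, these bases are orthonormal and complete. -/
theorem IsListing.exists_hilbertBasis [CompleteSpace H] {T : H →L[ℝ] H} (hT : IsCompactOperator T)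
    (hs : T.IsSymmetric) (hinj : ∀ f, T f = 0 → f = 0) {lam : ℕ → ℝ} (hl : IsListing T lam) :
    ∃ b : HilbertBasis ℕ ℝ H, ∀ j, b j = lam j • T (b j) := by
  have hex : ∀ μ, ∃ v : {j // lam j = μ} → H, Orthonormal ℝ v ∧
      Submodule.span ℝ (Set.range v) = invEigenspace T μ := by
    intro μ
    have := finiteDimensional_invEigenspace hT μ
    have hcard := hl.2 μ
    rw [toENat_rank_invEigenspace hT] at hcard
    have hfin : {j | lam j = μ}.Finite := Set.finite_of_encard_eq_coe hcard
    have : Finite {j // lam j = μ} := hfin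
    have hc : Nat.card {j // lam j = μ} = Module.finrank ℝ (invEigenspace T μ) := by
      change Set.ncard {j | lam j = μ} = _
      rw [Set.ncard_def, hcard]
      rfl
    have : Fintype {j // lam j = μ} := Fintype.ofFinite _
    let B := (stdOrthonormalBasis ℝ (invEigenspace T μ)).reindex
      (Finite.equivFinOfCardEq hc).symm
    refine ⟨fun j => (B j : H), ?_, ?_⟩
    · exact B.orthonormal.comp_linearIsometry (invEigenspace T μ).subtypeₗᵢ
    · have h1 : Set.range (fun j => (B j : H)) = (invEigenspace T μ).subtype '' Set.range B := by
        rw [← Set.range_comp]; rfl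
      rw [h1, Submodule.span_image, ← OrthonormalBasis.coe_toBasis, B.toBasis.span_eq,
        Submodule.map_top, Submodule.range_subtype]
  choose v hv hspan using hex
  let b : ℕ → H := fun j => v (lam j) ⟨j, rfl⟩
  have hb : ∀ j μ (h : lam j = μ), b j = v μ ⟨j, h⟩ := by
    rintro j μ rfl
    rfl
  have hmem : ∀ j, b j ∈ invEigenspace T (lam j) := fun j => by
    rw [← hspan]
    exact Submodule.subset_span ⟨_, rfl⟩
  have hon : Orthonormal ℝ b := by
    refine ⟨fun j => (hv _).1 _, fun i j hij => ?_⟩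
    by_cases h : lam i = lam j
    · change inner ℝ (b i) (b j) = 0
      rw [hb i _ h, hb j _ rfl]
      exact (hv _).2 (by simpa using hij)
    · exact inner_eq_zero_of_mem_invEigenspace hs h (hmem i) (hmem j)
  have hbot : (Submodule.span ℝ (Set.range b))ᗮ = ⊥ := by
    rw [eq_bot_iff]
    intro f hf
    rw [Submodule.mem_orthogonal] at hf
    rw [Submodule.mem_bot]
    refine eq_zero_of_forall_invEigenspace_inner_eq_zero hT hs hinj fun μ p hp => ?_
    refine hf p ?_
    rw [← hspan] at hp
    refine Submodule.span_mono ?_ hp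
    rintro _ ⟨⟨j, hj⟩, rfl⟩
    exact ⟨j, hb j μ hj⟩
  refine ⟨HilbertBasis.mkOfOrthogonalEqBot hon hbot, fun j => ?_⟩
  rw [HilbertBasis.coe_mkOfOrthogonalEqBot]
  exact mem_invEigenspace.1 (hmem j)

/-- Parseval's identity, with `T` diagonal in the basis `b` and diagonal entries `(lam j)⁻¹`. -/
theorem hasSum_inner_apply_self {T : H →L[ℝ] H} (hs : T.IsSymmetric) {lam : ℕ → ℝ}
    (b : HilbertBasis ℕ ℝ H) (hb : ∀ j, b j = lam j • T (b j)) (f : H) :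
    HasSum (fun j => (lam j)⁻¹ * inner ℝ (b j) f ^ 2) (inner ℝ f (T f)) := by
  convert! b.hasSum_inner_mul_inner f (T f) using 2 with j
  have h0 : lam j ≠ 0 := fun h => by
    have := hb j
    rw [h, zero_smul] at this
    exact b.orthonormal.ne_zero j this
  have h1 : inner ℝ (b j) f = lam j * inner ℝ (b j) (T f) := by
    conv_lhs => rw [hb j, real_inner_smul_left]
    rw [show inner ℝ (T (b j)) f = inner ℝ (b j) (T f) from hs _ _]
  rw [real_inner_comm (b j) f, pow_two]
  conv_lhs => rw [h1]
  rw [h1]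
  field_simp

/-- Monotonicity of the eigenvalues in the quadratic form. -/
theorem le_of_quadraticForm_le {T₁ T₂ : H →L[ℝ] H} (hs₁ : T₁.IsSymmetric) (hs₂ : T₂.IsSymmetric)
    {lam₁ lam₂ : ℕ → ℝ} (hm₁ : Monotone lam₁) (hm₂ : Monotone lam₂) (hp₁ : ∀ j, 0 < lam₁ j)
    (hp₂ : ∀ j, 0 < lam₂ j) (b₁ b₂ : HilbertBasis ℕ ℝ H) (hb₁ : ∀ j, b₁ j = lam₁ j • T₁ (b₁ j))
    (hb₂ : ∀ j, b₂ j = lam₂ j • T₂ (b₂ j)) {c : ℝ} (hc : 0 ≤ c)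
    (h : ∀ f, c * inner ℝ f (T₂ f) ≤ inner ℝ f (T₁ f)) (j : ℕ) : c * lam₁ j ≤ lam₂ j := by
  -- Only `j` orthogonality conditions are imposed on `j + 1` coefficients, so some nonzero `f` in
  -- the span of `b₂ 0, …, b₂ j` is orthogonal to `b₁ 0, …, b₁ (j - 1)`. This `f` compares both
  -- quadratic forms.
  let A : (Fin (j + 1) → ℝ) →ₗ[ℝ] (Fin j → ℝ) :=
    LinearMap.pi fun i => (innerSL ℝ (b₁ i)).toLinearMap ∘ₗ
      Fintype.linearCombination ℝ (fun k : Fin (j + 1) => b₂ k)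
  have hker : LinearMap.ker A ≠ ⊥ := LinearMap.ker_ne_bot_of_finrank_lt (by simp)
  obtain ⟨a, ha, ha0⟩ := Submodule.exists_mem_ne_zero_of_ne_bot hker
  set f : H := ∑ k : Fin (j + 1), a k • b₂ k with hf
  have hA : ∀ i < j, inner ℝ (b₁ i) f = 0 := fun i hi => by
    have := congrFun (LinearMap.mem_ker.1 ha) ⟨i, hi⟩
    simpa [A, Fintype.linearCombination_apply] using this
  have hf0 : f ≠ 0 := fun h0 => by
    have hli : LinearIndependent ℝ (fun k : Fin (j + 1) => b₂ k) :=
      b₂.orthonormal.linearIndependent.comp (fun k : Fin (j + 1) => (k : ℕ)) Fin.val_injective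
    exact ha0 (funext (Fintype.linearIndependent_iff.1 hli a h0))
  have hout : ∀ i, j < i → inner ℝ (b₂ i) f = 0 := fun i hi => by
    rw [hf, inner_sum]
    refine Finset.sum_eq_zero fun k _ => ?_
    rw [real_inner_smul_right, b₂.orthonormal.2 (by have := k.2; omega), mul_zero]
  have hpars : ∀ b : HilbertBasis ℕ ℝ H,
      HasSum (fun i => inner ℝ (b i) f ^ 2) (inner ℝ f f) := fun b => by
    convert! b.hasSum_inner_mul_inner f f using 2 with i
    rw [real_inner_comm (b i) f, pow_two]
  have h1 : inner ℝ f (T₁ f) ≤ (lam₁ j)⁻¹ * inner ℝ f f := by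
    refine hasSum_le (fun i => ?_) (hasSum_inner_apply_self hs₁ b₁ hb₁ f)
      ((hpars b₁).mul_left (lam₁ j)⁻¹)
    rcases lt_or_ge i j with hij | hij
    · rw [hA i hij]; simp
    · have := inv_anti₀ (hp₁ j) (hm₁ hij)
      gcongr
  have h2 : (lam₂ j)⁻¹ * inner ℝ f f ≤ inner ℝ f (T₂ f) := by
    refine hasSum_le (fun i => ?_) ((hpars b₂).mul_left (lam₂ j)⁻¹)
      (hasSum_inner_apply_self hs₂ b₂ hb₂ f)
    rcases lt_or_ge j i with hij | hij
    · rw [hout i hij]; simp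
    · have := inv_anti₀ (hp₂ i) (hm₂ hij)
      gcongr
  have hff : 0 < inner ℝ f f := real_inner_self_pos.2 hf0
  have h3 : c * (lam₂ j)⁻¹ * inner ℝ f f ≤ (lam₁ j)⁻¹ * inner ℝ f f := by
    have := mul_le_mul_of_nonneg_left h2 hc
    linarith [h f]
  have h4 := le_of_mul_le_mul_right h3 hff
  have e1 := hp₁ j
  have e2 := hp₂ j
  rw [← div_eq_mul_inv, div_le_iff₀ e2, inv_mul_eq_div, le_div_iff₀ e1] at h4
  exact h4

theorem pos_of_mem_invEigenspace {T : H →L[ℝ] H} (hpos : ∀ f, 0 ≤ inner ℝ f (T f)) {μ : ℝ} {p : H}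
    (hp : p ∈ invEigenspace T μ) (h0 : p ≠ 0) : 0 < μ := by
  rw [mem_invEigenspace] at hp
  by_contra hμ
  have h1 : inner ℝ p p = μ * inner ℝ p (T p) := by
    rw [← real_inner_smul_right, ← hp]
  have h2 := real_inner_self_pos.2 h0
  nlinarith [hpos p]

/-- Infinitely many such `μ` would give orthonormal vectors whose images under `T` are at pairwise
distance at least `R⁻¹`, so without convergent subsequence. -/
theorem finite_setOf_invEigenspace_ne_bot {T : H →L[ℝ] H} (hT : IsCompactOperator T)
    (hs : T.IsSymmetric) (hpos : ∀ f, 0 ≤ inner ℝ f (T f)) (R : ℝ) :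
    {μ | μ ≤ R ∧ invEigenspace T μ ≠ ⊥}.Finite := by
  by_contra hinf
  have hinf : Set.Infinite {μ | μ ≤ R ∧ invEigenspace T μ ≠ ⊥} := hinf
  let ν := hinf.natEmbedding
  have hν : ∀ n, ∃ p : H, p ∈ invEigenspace T (ν n) ∧ ‖p‖ = 1 := fun n => by
    obtain ⟨p, hp, hp0⟩ := Submodule.exists_mem_ne_zero_of_ne_bot (ν n).2.2
    exact ⟨‖p‖⁻¹ • p, Submodule.smul_mem _ _ hp, norm_smul_inv_norm hp0⟩
  choose p hp hn using hν
  have hne : ∀ n, p n ≠ 0 := fun n h => by simpa [h] using hn n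
  have hνpos : ∀ n, 0 < (ν n : ℝ) := fun n => pos_of_mem_invEigenspace hpos (hp n) (hne n)
  have hR : 0 < R := (hνpos 0).trans_le (ν 0).2.1
  have hTp : ∀ n, T (p n) = (ν n : ℝ)⁻¹ • p n := fun n => by
    conv_rhs => rw [mem_invEigenspace.1 (hp n)]
    rw [inv_smul_smul₀ (hνpos n).ne']
  have hdist : ∀ m n, m ≠ n → R⁻¹ ≤ ‖T (p m) - T (p n)‖ := fun m n hmn => by
    have hort : inner ℝ (T (p m)) (T (p n)) = 0 := by
      rw [hTp, hTp, real_inner_smul_left, real_inner_smul_right,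
        inner_eq_zero_of_mem_invEigenspace hs
          (fun h => hmn (ν.injective (Subtype.ext h))) (hp m) (hp n)]
      simp
    have h1 : R⁻¹ ≤ ‖T (p m)‖ := by
      rw [hTp, norm_smul, hn, mul_one, norm_inv, Real.norm_of_nonneg (hνpos m).le]
      exact inv_anti₀ (hνpos m) (ν m).2.1
    have h2 : ‖T (p m) - T (p n)‖ ^ 2 = ‖T (p m)‖ ^ 2 + ‖T (p n)‖ ^ 2 := by
      rw [norm_sub_sq_real, hort]; ring
    refine h1.trans (abs_le_of_sq_le_sq' ?_ (norm_nonneg _)).2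
    rw [h2]
    nlinarith [sq_nonneg ‖T (p n)‖]
  obtain ⟨K, hK, hKs⟩ := hT.image_closedBall_subset_compact (𝕜₁ := ℝ) (f := (T : H →ₗ[ℝ] H)) 1
  obtain ⟨x, -, φ, hφ, hlim⟩ := hK.tendsto_subseq (x := fun n => T (p n))
    fun n => hKs ⟨p n, by simp [hn n], rfl⟩
  have hc := hlim.cauchySeq
  rw [Metric.cauchySeq_iff'] at hc
  obtain ⟨N, hN⟩ := hc R⁻¹ (inv_pos.2 hR)
  have h1 := hN (N + 1) (Nat.le_succ N)
  rw [dist_eq_norm] at h1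
  exact absurd h1 (not_lt.2 (hdist _ _ (hφ (Nat.lt_succ_self N)).ne'))

theorem exists_isListing [CompleteSpace H] {T : H →L[ℝ] H} (hT : IsCompactOperator T)
    (hs : T.IsSymmetric) (hpos : ∀ f, 0 ≤ inner ℝ f (T f)) (hinj : ∀ f, T f = 0 → f = 0)
    (hH : ¬ FiniteDimensional ℝ H) : ∃ lam : ℕ → ℝ, IsListing T lam := by
  let m : ℝ → ℕ := fun μ => Module.finrank ℝ (invEigenspace T μ)
  have hm : ∀ μ, m μ ≠ 0 → invEigenspace T μ ≠ ⊥ := fun μ h hbot => by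
    apply h
    simp only [m]
    rw [hbot, finrank_bot]
  -- Each `μ` occurs as `(μ, 0), …, (μ, m μ - 1)`; the lexicographic order then lists values
  -- increasingly with multiplicity.
  let I := {x : ℝ ×ₗ ℕ // (ofLex x).2 < m (ofLex x).1}
  have hI : ∀ x : I, (Set.Iic x).Finite := fun x => by
    have hfin : (Sigma.fst ⁻¹' {μ | μ ≤ (ofLex x.1).1 ∧ invEigenspace T μ ≠ ⊥} :
        Set (Σ μ : ℝ, Fin (m μ))).Finite := by
      have := finite_setOf_invEigenspace_ne_bot hT hs hpos (ofLex x.1).1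
      refine this.preimage' fun μ _ => ?_
      refine (Set.finite_range (Sigma.mk (β := fun μ : ℝ => Fin (m μ)) μ)).subset ?_
      rintro ⟨_, i⟩ rfl
      exact ⟨i, rfl⟩
    refine Set.Finite.subset (hfin.image fun y => (⟨toLex (y.1, (y.2 : ℕ)), y.2.2⟩ : I)) ?_
    rintro ⟨y, hy⟩ hyx
    refine ⟨⟨(ofLex y).1, ⟨(ofLex y).2, hy⟩⟩, ⟨?_, hm _ (Nat.ne_zero_of_lt hy)⟩, rfl⟩
    exact (Prod.Lex.monotone_fst _ _ hyx)
  -- If `I` were finite, the sum of the eigenspaces would be finite dimensional with trivial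
  -- orthogonal complement, hence all of `H`.
  have : Infinite I := by
    by_contra hni
    have : Finite I := not_infinite_iff_finite.1 hni
    apply hH
    let W : Submodule ℝ H := ⨆ x : I, invEigenspace T (ofLex x.1).1
    have : ∀ x : I, FiniteDimensional ℝ (invEigenspace T (ofLex x.1).1) :=
      fun x => finiteDimensional_invEigenspace hT _
    have : FiniteDimensional ℝ W := Submodule.finiteDimensional_iSup _
    have hW : Wᗮ = ⊥ := by
      rw [eq_bot_iff]
      intro f hf
      rw [Submodule.mem_bot]
      refine eq_zero_of_forall_invEigenspace_inner_eq_zero hT hs hinj fun μ p hp => ?_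
      refine (Submodule.mem_orthogonal _ _).1 hf p ?_
      by_cases h0 : m μ = 0
      · have := finiteDimensional_invEigenspace hT μ
        have : invEigenspace T μ = ⊥ := Submodule.finrank_eq_zero.1 h0
        rw [this, Submodule.mem_bot] at hp
        rw [hp]
        exact W.zero_mem
      · exact le_iSup (fun x : I => invEigenspace T (ofLex x.1).1)
          ⟨toLex (μ, 0), Nat.pos_of_ne_zero h0⟩ hp
    have hWtop : W = ⊤ := Submodule.orthogonal_eq_bot_iff.1 hW
    rw [hWtop] at this
    exact Module.Finite.equiv (Submodule.topEquiv (R := ℝ) (M := H))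
  obtain ⟨e⟩ := nonempty_orderIso_nat_of_finite_Iic I hI
  refine ⟨fun j => (ofLex (e j).1).1, fun i j hij => ?_, fun μ => ?_⟩
  · exact Prod.Lex.monotone_fst _ _ (e.monotone hij)
  · rw [toENat_rank_invEigenspace hT]
    have h1 : {j | (ofLex (e j).1).1 = μ} =
        e.symm '' Set.range fun k : Fin (m μ) => (⟨toLex (μ, (k : ℕ)), k.2⟩ : I) := by
      ext j
      constructor
      · rintro rfl
        exact ⟨e j, ⟨⟨_, (e j).2⟩, rfl⟩, e.symm_apply_apply j⟩
      · rintro ⟨_, ⟨k, rfl⟩, rfl⟩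
        simp
    rw [h1, e.symm.injective.encard_image, ← Set.image_univ, Function.Injective.encard_image,
      Set.encard_univ, ENat.card_eq_coe_fintype_card, Fintype.card_fin]
    intro k l hkl
    have := congrArg (fun x : I => (ofLex x.1).2) hkl
    exact Fin.ext this

end CompactSpectrum

/-! ### Sobolev calculus on one edge -/

namespace MetricGraph

/-- Cauchy–Schwarz against the indicator of `(s, t]`. This Hölder bound is the source of
compactness. -/
theorem abs_integral_le {ℓ s t : ℝ} (g : Lp ℝ 2 (edgeMeasure ℓ)) (hs : 0 ≤ s) (hst : s ≤ t)
    (ht : t ≤ ℓ) : |∫ x in s..t, g x| ≤ √(t - s) * ‖g‖ := by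
  have hsub : Set.Ioc s t ⊆ Set.Ioc 0 ℓ := Set.Ioc_subset_Ioc hs ht
  have h1 := L2.inner_indicatorConstLp_one (𝕜 := ℝ) (μ := edgeMeasure ℓ)
    (measurableSet_Ioc : MeasurableSet (Set.Ioc s t)) (measure_ne_top _ _) g
  rw [Measure.restrict_restrict measurableSet_Ioc, Set.inter_eq_left.2 hsub,
    ← intervalIntegral.integral_of_le hst] at h1
  rw [← h1]
  refine (abs_real_inner_le_norm _ _).trans ?_
  gcongr
  refine (norm_indicatorConstLp_le).trans_eq ?_
  rw [measureReal_restrict_apply measurableSet_Ioc, Set.inter_eq_left.2 hsub,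
    Real.volume_real_Ioc_of_le hst, norm_one, one_mul, Real.sqrt_eq_rpow]
  simp

theorem continuousOn_primitive {ℓ : ℝ} (hℓ : 0 ≤ ℓ) (g : Lp ℝ 2 (edgeMeasure ℓ)) :
    ContinuousOn (fun t => ∫ x in (0 : ℝ)..t, g x) (Set.Icc 0 ℓ) := by
  have h := intervalIntegral.continuousOn_primitive_interval'
    (intervalIntegrable_of_mem g (Set.right_mem_Icc.2 hℓ)) (Set.left_mem_uIcc)
  rwa [Set.uIcc_of_le hℓ] at h

theorem abs_primitive_le {ℓ : ℝ} (c : ℝ) (g : Lp ℝ 2 (edgeMeasure ℓ)) {t : ℝ}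
    (ht : t ∈ Set.Icc 0 ℓ) : |c + ∫ x in (0 : ℝ)..t, g x| ≤ |c| + √ℓ * ‖g‖ := by
  refine (abs_add_le _ _).trans ?_
  gcongr
  refine (abs_integral_le g le_rfl ht.1 ht.2).trans ?_
  rw [sub_zero]
  gcongr
  exact ht.2

theorem memLp_primitive {ℓ : ℝ} (hℓ : 0 ≤ ℓ) (c : ℝ) (g : Lp ℝ 2 (edgeMeasure ℓ)) :
    MemLp (fun t => c + ∫ x in (0 : ℝ)..t, g x) 2 (edgeMeasure ℓ) := by
  refine MemLp.of_bound (((continuousOn_const.add (continuousOn_primitive hℓ g)).mono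
    Set.Ioc_subset_Icc_self).aestronglyMeasurable measurableSet_Ioc) (|c| + √ℓ * ‖g‖) ?_
  filter_upwards [ae_restrict_mem measurableSet_Ioc] with t ht
  exact abs_primitive_le c g (Set.Ioc_subset_Icc_self ht)

theorem integral_coeFn_add {ℓ t : ℝ} (g h : Lp ℝ 2 (edgeMeasure ℓ)) (ht : t ∈ Set.Icc (0 : ℝ) ℓ) :
    ∫ x in (0 : ℝ)..t, (g + h : Lp ℝ 2 (edgeMeasure ℓ)) x =
      (∫ x in (0 : ℝ)..t, g x) + ∫ x in (0 : ℝ)..t, h x := by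
  rw [← intervalIntegral.integral_add (intervalIntegrable_of_mem g ht)
    (intervalIntegrable_of_mem h ht)]
  exact intervalIntegral.integral_congr_ae (ae_restrict_of_mem ht (Lp.coeFn_add g h))

theorem integral_coeFn_smul {ℓ t : ℝ} (a : ℝ) (g : Lp ℝ 2 (edgeMeasure ℓ))
    (ht : t ∈ Set.Icc (0 : ℝ) ℓ) :
    ∫ x in (0 : ℝ)..t, (a • g : Lp ℝ 2 (edgeMeasure ℓ)) x = a * ∫ x in (0 : ℝ)..t, g x := by
  rw [← intervalIntegral.integral_const_mul]
  exact intervalIntegral.integral_congr_ae (ae_restrict_of_mem ht (Lp.coeFn_smul a g))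

/-- The function `t ↦ c + ∫₀ᵗ g` as an element of `L²(0, ℓ)`. -/
noncomputable def primitiveₗ (ℓ : ℝ) (hℓ : 0 ≤ ℓ) :
    ℝ × Lp ℝ 2 (edgeMeasure ℓ) →ₗ[ℝ] Lp ℝ 2 (edgeMeasure ℓ) where
  toFun x := (memLp_primitive hℓ x.1 x.2).toLp _
  map_add' x y := by
    refine Lp.ext ?_
    filter_upwards [(memLp_primitive hℓ (x + y).1 (x + y).2).coeFn_toLp,
      (memLp_primitive hℓ x.1 x.2).coeFn_toLp, (memLp_primitive hℓ y.1 y.2).coeFn_toLp,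
      Lp.coeFn_add ((memLp_primitive hℓ x.1 x.2).toLp _) ((memLp_primitive hℓ y.1 y.2).toLp _),
      ae_restrict_mem measurableSet_Ioc] with t h1 h2 h3 h4 ht
    rw [h1, h4, Pi.add_apply, h2, h3, Prod.fst_add, Prod.snd_add,
      integral_coeFn_add _ _ (Set.Ioc_subset_Icc_self ht)]
    ring
  map_smul' a x := by
    have hx := memLp_primitive hℓ x.1 x.2
    refine Lp.ext ?_
    filter_upwards [(memLp_primitive hℓ (a • x).1 (a • x).2).coeFn_toLp,
      hx.coeFn_toLp, Lp.coeFn_smul a (hx.toLp _),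
      ae_restrict_mem measurableSet_Ioc] with t h1 h2 h3 ht
    rw [h1, RingHom.id_apply, h3, Pi.smul_apply, h2, Prod.smul_fst, Prod.smul_snd,
      integral_coeFn_smul _ _ (Set.Ioc_subset_Icc_self ht), smul_eq_mul, smul_eq_mul]
    ring

theorem norm_primitiveₗ_le (ℓ : ℝ) (hℓ : 0 ≤ ℓ) (x : ℝ × Lp ℝ 2 (edgeMeasure ℓ)) :
    ‖primitiveₗ ℓ hℓ x‖ ≤
      (measureUnivNNReal (edgeMeasure ℓ) : ℝ) ^ (2 : ENNReal).toReal⁻¹ * (1 + √ℓ) * ‖x‖ := by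
  have h1 : |x.1| + √ℓ * ‖x.2‖ ≤ (1 + √ℓ) * ‖x‖ := by
    have e1 : |x.1| ≤ ‖x‖ := norm_fst_le x
    have e2 : ‖x.2‖ ≤ ‖x‖ := norm_snd_le x
    have := mul_le_mul_of_nonneg_left e2 (Real.sqrt_nonneg ℓ)
    linarith
  rw [mul_assoc]
  refine Lp.norm_le_of_ae_bound (by positivity) ?_
  filter_upwards [(memLp_primitive hℓ x.1 x.2).coeFn_toLp,
    ae_restrict_mem measurableSet_Ioc] with t h ht
  change ‖((memLp_primitive hℓ x.1 x.2).toLp _ : Lp ℝ 2 (edgeMeasure ℓ)) t‖ ≤ _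
  rw [h]
  exact (abs_primitive_le _ _ (Set.Ioc_subset_Icc_self ht)).trans h1

/-- The bounded operator `(c, g) ↦ c + ∫₀ᵗ g` from `ℝ × L²(0, ℓ)` to `L²(0, ℓ)`. -/
noncomputable def primitive (ℓ : ℝ) (hℓ : 0 ≤ ℓ) :
    ℝ × Lp ℝ 2 (edgeMeasure ℓ) →L[ℝ] Lp ℝ 2 (edgeMeasure ℓ) :=
  (primitiveₗ ℓ hℓ).mkContinuous _ (norm_primitiveₗ_le ℓ hℓ)

theorem coeFn_primitive {ℓ : ℝ} (hℓ : 0 ≤ ℓ) (x : ℝ × Lp ℝ 2 (edgeMeasure ℓ)) :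
    ∀ᵐ t ∂(edgeMeasure ℓ), primitive ℓ hℓ x t = x.1 + ∫ s in (0 : ℝ)..t, x.2 s :=
  (memLp_primitive hℓ x.1 x.2).coeFn_toLp

theorem isH1Rep_primitive {ℓ : ℝ} (hℓ : 0 ≤ ℓ) (c : ℝ) (g : Lp ℝ 2 (edgeMeasure ℓ)) :
    IsH1Rep ℓ (fun t => c + ∫ s in (0 : ℝ)..t, g s) (primitive ℓ hℓ (c, g)) g := by
  refine ⟨?_, fun t _ => by simp⟩
  filter_upwards [coeFn_primitive hℓ (c, g)] with t ht
  exact ht.symm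

theorem IsH1Rep.eq_primitive {ℓ : ℝ} (hℓ : 0 ≤ ℓ) {F : ℝ → ℝ} {f g : Lp ℝ 2 (edgeMeasure ℓ)}
    (h : IsH1Rep ℓ F f g) : f = primitive ℓ hℓ (F 0, g) := by
  refine Lp.ext ?_
  filter_upwards [h.1, coeFn_primitive hℓ (F 0, g), ae_restrict_mem measurableSet_Ioc]
    with t h1 h2 ht
  rw [h2, ← h1]
  exact h.2 t (Set.Ioc_subset_Icc_self ht)

/-- The functional `g ↦ ∫₀ᵗ g` on `L²(0, ℓ)`. -/
noncomputable def integralTo (ℓ t : ℝ) : Lp ℝ 2 (edgeMeasure ℓ) →L[ℝ] ℝ :=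
  innerSL ℝ (indicatorConstLp 2 (measurableSet_Ioc : MeasurableSet (Set.Ioc 0 t))
    (measure_ne_top (edgeMeasure ℓ) _) (1 : ℝ))

theorem integralTo_apply {ℓ t : ℝ} (ht : t ∈ Set.Icc 0 ℓ) (g : Lp ℝ 2 (edgeMeasure ℓ)) :
    integralTo ℓ t g = ∫ x in (0 : ℝ)..t, g x := by
  rw [integralTo, innerSL_apply_apply, L2.inner_indicatorConstLp_one,
    Measure.restrict_restrict measurableSet_Ioc,
    Set.inter_eq_left.2 (Set.Ioc_subset_Ioc_right ht.2), intervalIntegral.integral_of_le ht.1]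

/-- Reducing the index modulo `N + 1` makes the function total; on `(0, ℓ]` the reduction changes
nothing. For `N > 0` the last index `N` is reached there only at `t = ℓ`. -/
theorem memLp_step (ℓ : ℝ) (N : ℕ) (a : Fin (N + 1) → ℝ) :
    MemLp (fun t : ℝ => a (Fin.ofNat (N + 1) ⌊t * N / ℓ⌋₊)) 2 (edgeMeasure ℓ) := by
  have hm : Measurable fun t : ℝ => a (Fin.ofNat (N + 1) ⌊t * N / ℓ⌋₊) :=
    (measurable_from_nat (f := fun k => a (Fin.ofNat (N + 1) k))).comp
      (Nat.measurable_floor.comp (by fun_prop))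
  exact MemLp.of_bound hm.aestronglyMeasurable ‖a‖ (ae_of_all _ fun t => norm_le_pi_norm a _)

/-- Step functions on `N` equal subintervals of `(0, ℓ]`. -/
noncomputable def stepFunction (ℓ : ℝ) (N : ℕ) :
    (Fin (N + 1) → ℝ) →ₗ[ℝ] Lp ℝ 2 (edgeMeasure ℓ) where
  toFun a := (memLp_step ℓ N a).toLp
  map_add' a b := MemLp.toLp_add (memLp_step ℓ N a) (memLp_step ℓ N b)
  map_smul' c a := MemLp.toLp_const_smul c (memLp_step ℓ N a)

/-- The values of `t ↦ c + ∫₀ᵗ g` at the end points of `N` equal subintervals of `(0, ℓ]`. -/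
noncomputable def nodeValues (ℓ : ℝ) (N : ℕ) :
    ℝ × Lp ℝ 2 (edgeMeasure ℓ) →L[ℝ] (Fin (N + 1) → ℝ) :=
  ContinuousLinearMap.pi fun k => ContinuousLinearMap.fst ℝ _ _ +
    (integralTo ℓ ((k : ℕ) * ℓ / N)).comp (ContinuousLinearMap.snd ℝ _ _)

/-- A primitive differs from its value at the nearest node to the left by at most `√(ℓ / N)` times
the norm of the derivative. -/
theorem norm_primitive_sub_step_le {ℓ : ℝ} (hℓ : 0 < ℓ) {N : ℕ} (hN : 0 < N) :
    ‖primitive ℓ hℓ.le -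
        (stepFunction ℓ N).toContinuousLinearMap.comp (nodeValues ℓ N)‖ ≤
      (measureUnivNNReal (edgeMeasure ℓ) : ℝ) ^ (2 : ENNReal).toReal⁻¹ * √(ℓ / N) := by
  refine ContinuousLinearMap.opNorm_le_bound _ (by positivity) fun x => ?_
  rw [mul_assoc]
  refine Lp.norm_le_of_ae_bound (by positivity) ?_
  have hN' : (0 : ℝ) < N := Nat.cast_pos.2 hN
  filter_upwards [coeFn_primitive hℓ.le x, (memLp_step ℓ N (nodeValues ℓ N x)).coeFn_toLp,
    Lp.coeFn_sub (primitive ℓ hℓ.le x) (memLp_step ℓ N (nodeValues ℓ N x)).toLp,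
    ae_restrict_mem measurableSet_Ioc] with t h1 h2 h3 ht
  change ‖(primitive ℓ hℓ.le x - (memLp_step ℓ N (nodeValues ℓ N x)).toLp :
    Lp ℝ 2 (edgeMeasure ℓ)) t‖ ≤ _
  rw [h3, Pi.sub_apply, h1, h2]
  set k := ⌊t * N / ℓ⌋₊ with hk
  have hk1 : (k : ℝ) ≤ t * N / ℓ :=
    Nat.floor_le (div_nonneg (mul_nonneg ht.1.le hN'.le) hℓ.le)
  have hk2 : t * N / ℓ < k + 1 := Nat.lt_floor_add_one _
  have hkN : k < N + 1 := by
    have h4 : t * N / ℓ ≤ N := by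
      rw [div_le_iff₀ hℓ, mul_comm (N : ℝ)]
      exact mul_le_mul_of_nonneg_right ht.2 hN'.le
    have h5 : (k : ℝ) < N + 1 := by linarith
    exact_mod_cast h5
  have hkv : ((Fin.ofNat (N + 1) k : Fin (N + 1)) : ℕ) = k := Nat.mod_eq_of_lt hkN
  have hs1 : (k : ℝ) * ℓ / N ≤ t := by
    rw [le_div_iff₀ hℓ] at hk1
    rwa [div_le_iff₀ hN']
  have hs2 : t - k * ℓ / N ≤ ℓ / N := by
    rw [div_lt_iff₀ hℓ] at hk2
    rw [sub_le_iff_le_add, ← add_div, le_div_iff₀ hN']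
    linarith
  have hs0 : 0 ≤ (k : ℝ) * ℓ / N := by positivity
  have hnode : nodeValues ℓ N x (Fin.ofNat (N + 1) k) =
      x.1 + ∫ s in (0 : ℝ)..((k : ℝ) * ℓ / N), x.2 s := by
    rw [← integralTo_apply ⟨hs0, hs1.trans ht.2⟩]
    simp only [nodeValues, ContinuousLinearMap.coe_pi', hkv]
    rfl
  rw [hnode, add_sub_add_left_eq_sub, intervalIntegral.integral_interval_sub_left
    (intervalIntegrable_of_mem _ (Set.Ioc_subset_Icc_self ht))
    (intervalIntegrable_of_mem _ ⟨hs0, hs1.trans ht.2⟩)]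
  refine (abs_integral_le x.2 hs0 hs1 ht.2).trans ?_
  have := norm_snd_le x
  gcongr

/-- The operator is a norm limit of the finite-rank operators that sample at the nodes. -/
theorem isCompactOperator_primitive {ℓ : ℝ} (hℓ : 0 < ℓ) :
    IsCompactOperator (primitive ℓ hℓ.le) := by
  have hlim : Filter.Tendsto (fun N : ℕ => (stepFunction ℓ N).toContinuousLinearMap.comp
      (nodeValues ℓ N)) Filter.atTop (nhds (primitive ℓ hℓ.le)) := by
    rw [tendsto_iff_norm_sub_tendsto_zero]
    refine squeeze_zero' (g := fun N : ℕ =>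
      (measureUnivNNReal (edgeMeasure ℓ) : ℝ) ^ (2 : ENNReal).toReal⁻¹ * √(ℓ / N))
      (Filter.Eventually.of_forall fun _ => norm_nonneg _)
      (Filter.eventually_atTop.2 ⟨1, fun N hN => by
        rw [norm_sub_rev]; exact norm_primitive_sub_step_le hℓ hN⟩) ?_
    have h1 : Filter.Tendsto (fun N : ℕ => √(ℓ / N)) Filter.atTop (nhds 0) := by
      rw [← Real.sqrt_zero]
      exact (Real.continuous_sqrt.tendsto 0).comp (tendsto_const_div_atTop_nhds_zero_nat ℓ)
    simpa using h1.const_mul ((measureUnivNNReal (edgeMeasure ℓ) : ℝ) ^ (2 : ENNReal).toReal⁻¹)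
  refine isCompactOperator_of_tendsto hlim (Filter.Eventually.of_forall fun N => ?_)
  exact (isCompactOperator_of_locallyCompactSpace_rng
    (stepFunction ℓ N).toContinuousLinearMap).comp_clm (nodeValues ℓ N)

theorem eq_zero_of_forall_integral_eq_zero {ℓ : ℝ} (hℓ : 0 ≤ ℓ) {g : Lp ℝ 2 (edgeMeasure ℓ)}
    (h : ∀ t ∈ Set.Icc 0 ℓ, ∫ x in (0 : ℝ)..t, g x = 0) : g = 0 := by
  have hI := intervalIntegrable_of_mem g (Set.right_mem_Icc.2 hℓ)
  have hd := hI.ae_hasDerivAt_integral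
  rw [Set.uIcc_of_le hℓ] at hd
  -- The end point is discarded because the primitive is known to vanish only on `[0, ℓ]`, not on a
  -- neighbourhood of `ℓ`.
  have hne : ∀ᵐ x : ℝ, x ≠ ℓ := by simp [ae_iff, measure_singleton]
  rw [Lp.eq_zero_iff_ae_eq_zero]
  refine (ae_restrict_iff' measurableSet_Ioc).2 ?_
  filter_upwards [hd, hne] with x hx hxℓ hmem
  have h1 := hx (Set.Ioc_subset_Icc_self hmem) 0 (Set.left_mem_Icc.2 hℓ)
  have h2 : (fun t => ∫ s in (0 : ℝ)..t, g s) =ᶠ[nhds x] fun _ => 0 := by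
    filter_upwards [Ioo_mem_nhds hmem.1 (lt_of_le_of_ne hmem.2 hxℓ)] with t ht
    exact h t (Set.Ioo_subset_Icc_self ht)
  exact h1.unique ((hasDerivAt_const x 0).congr_of_eventuallyEq h2)

/-- A function in `H¹(0, ℓ)` is determined by its class: the continuous representatives and the weak
derivatives of equal functions agree. -/
theorem IsH1Rep.eq_zero_of_zero {ℓ : ℝ} (hℓ : 0 < ℓ) {F : ℝ → ℝ} {g : Lp ℝ 2 (edgeMeasure ℓ)}
    (h : IsH1Rep ℓ F 0 g) : (∀ t ∈ Set.Icc 0 ℓ, F t = 0) ∧ g = 0 := by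
  have hc : ContinuousOn F (Set.Icc 0 ℓ) :=
    (continuousOn_const.add (continuousOn_primitive hℓ.le g)).congr fun t ht => h.2 t ht
  have h0 : F =ᵐ[volume.restrict (Set.Icc 0 ℓ)] fun _ => 0 := by
    rw [← restrict_Ioc_eq_restrict_Icc]
    filter_upwards [h.1, Lp.coeFn_zero ℝ 2 (edgeMeasure ℓ)] with t h1 h2
    rw [h1, h2]; rfl
  have h1 : ∀ t ∈ Set.Icc 0 ℓ, F t = 0 :=
    Measure.eqOn_Icc_of_ae_eq volume hℓ.ne h0 hc continuousOn_const
  refine ⟨h1, eq_zero_of_forall_integral_eq_zero hℓ.le fun t ht => ?_⟩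
  have := h.2 t ht
  rw [h1 t ht, h1 0 (Set.left_mem_Icc.2 hℓ.le)] at this
  linarith

theorem edge_inner_def {ℓ : ℝ} (hℓ : 0 ≤ ℓ) (f g : Lp ℝ 2 (edgeMeasure ℓ)) :
    inner ℝ f g = ∫ x in (0 : ℝ)..ℓ, f x * g x := by
  rw [L2.inner_def, intervalIntegral.integral_of_le hℓ]
  refine integral_congr_ae (ae_of_all _ fun x => ?_)
  simp [mul_comm]

theorem intervalIntegrable_mul {ℓ : ℝ} (hℓ : 0 ≤ ℓ) (f g : Lp ℝ 2 (edgeMeasure ℓ)) :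
    IntervalIntegrable (fun x => f x * g x) volume 0 ℓ := by
  rw [intervalIntegrable_iff_integrableOn_Ioc_of_le hℓ]
  refine (L2.integrable_inner (𝕜 := ℝ) f g).congr (ae_of_all _ fun x => ?_)
  simp [mul_comm]

/-- Integration by parts on an edge. -/
theorem IsH1Rep.inner_add_inner {ℓ : ℝ} (hℓ : 0 ≤ ℓ) {F G : ℝ → ℝ}
    {f f' g g' : Lp ℝ 2 (edgeMeasure ℓ)} (hF : IsH1Rep ℓ F f f') (hG : IsH1Rep ℓ G g g') :
    inner ℝ f' g + inner ℝ f g' = F ℓ * G ℓ - F 0 * G 0 := by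
  have hmem0 : (0 : ℝ) ∈ Set.uIcc 0 ℓ := Set.left_mem_uIcc
  have hFi := intervalIntegrable_of_mem f' (Set.right_mem_Icc.2 hℓ)
  have hGi := intervalIntegrable_of_mem g' (Set.right_mem_Icc.2 hℓ)
  -- The representative `F` is arbitrary off `[0, ℓ]`, so the integral formula replaces it; that
  -- function is absolutely continuous with a.e. derivative `f'`.
  have key : ∀ {F : ℝ → ℝ} {f f' : Lp ℝ 2 (edgeMeasure ℓ)}, IsH1Rep ℓ F f f' →
      AbsolutelyContinuousOnInterval (fun t => F 0 + ∫ x in (0 : ℝ)..t, f' x) 0 ℓ ∧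
      ∀ᵐ x, x ∈ Set.uIoc 0 ℓ → f x = F 0 + ∫ s in (0 : ℝ)..x, f' s ∧
        deriv (fun t => F 0 + ∫ x in (0 : ℝ)..t, f' x) x = f' x := by
    intro F f f' h
    have hi := intervalIntegrable_of_mem f' (Set.right_mem_Icc.2 hℓ)
    refine ⟨?_, ?_⟩
    · have h1 := hi.absolutelyContinuousOnInterval_intervalIntegral hmem0
      have h2 : AbsolutelyContinuousOnInterval (fun _ : ℝ => F 0) 0 ℓ :=
        (LipschitzWith.const (F 0)).lipschitzOnWith.absolutelyContinuousOnInterval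
      exact h2.add h1
    · filter_upwards [hi.ae_hasDerivAt_integral,
        ae_restrict_of_mem (Set.right_mem_Icc.2 hℓ) h.1] with x h1 h2 hx
      refine ⟨?_, ?_⟩
      · rw [← h2 hx]
        refine h.2 x ?_
        rw [← Set.uIcc_of_le hℓ]
        exact Set.uIoc_subset_uIcc hx
      · exact ((h1 (Set.uIoc_subset_uIcc hx) 0 hmem0).const_add (F 0)).deriv
  obtain ⟨acF, aeF⟩ := key hF
  obtain ⟨acG, aeG⟩ := key hG
  have h := acF.integral_deriv_mul_eq_sub acG
  rw [edge_inner_def hℓ, edge_inner_def hℓ, ← intervalIntegral.integral_add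
    (intervalIntegrable_mul hℓ _ _) (intervalIntegrable_mul hℓ _ _)]
  have e : ∫ x in (0 : ℝ)..ℓ, (f' x * g x + f x * g' x) = _ :=
    (intervalIntegral.integral_congr_ae (by
      filter_upwards [aeF, aeG] with x h1 h2 hx
      rw [(h1 hx).2, (h2 hx).2, (h1 hx).1, (h2 hx).1])).symm.trans h
  rw [e, ← hF.2 ℓ (Set.right_mem_Icc.2 hℓ), ← hG.2 ℓ (Set.right_mem_Icc.2 hℓ)]
  simp

/-- The indicators of the disjoint intervals `(ℓ / (n + 2), ℓ / (n + 1)]` are orthogonal and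
nonzero. -/
theorem not_finiteDimensional_edge {ℓ : ℝ} (hℓ : 0 < ℓ) :
    ¬ FiniteDimensional ℝ (Lp ℝ 2 (edgeMeasure ℓ)) := by
  intro hfin
  let S : ℕ → Set ℝ := fun n => Set.Ioc (ℓ / (n + 2)) (ℓ / (n + 1))
  let v : ℕ → Lp ℝ 2 (edgeMeasure ℓ) := fun n => indicatorConstLp 2
    (measurableSet_Ioc : MeasurableSet (S n)) (measure_ne_top (edgeMeasure ℓ) _) (1 : ℝ)
  have hlt : ∀ n : ℕ, ℓ / ((n : ℝ) + 2) < ℓ / ((n : ℝ) + 1) := fun n => by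
    gcongr
    norm_num
  have hsub : ∀ n, S n ⊆ Set.Ioc 0 ℓ := fun n => by
    refine Set.Ioc_subset_Ioc (by positivity) (div_le_self hℓ.le ?_)
    have : (0 : ℝ) ≤ n := Nat.cast_nonneg n
    linarith
  have hdisj : ∀ m n, m < n → S m ∩ S n = ∅ := fun m n hmn => by
    rw [Set.Ioc_inter_Ioc, Set.Ioc_eq_empty]
    rw [not_lt]
    refine (min_le_right _ _).trans (le_trans ?_ (le_max_left _ _))
    have : (m : ℝ) + 1 ≤ n := by exact_mod_cast hmn
    exact div_le_div_of_nonneg_left hℓ.le (by positivity) (by linarith)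
  have hin : ∀ m n, inner ℝ (v m) (v n) = (edgeMeasure ℓ).real (S m ∩ S n) := fun m n => by
    simp only [v]
    rw [L2.real_inner_indicatorConstLp_one_indicatorConstLp_one]
  have hli : LinearIndependent ℝ v := by
    refine linearIndependent_of_ne_zero_of_inner_eq_zero (𝕜 := ℝ) (fun n h0 => ?_)
      fun m n hmn => ?_
    · have h1 := hin n n
      rw [h0, inner_zero_left, Set.inter_self, measureReal_restrict_apply measurableSet_Ioc,
        Set.inter_eq_left.2 (hsub n), Real.volume_real_Ioc_of_le (hlt n).le] at h1
      linarith [hlt n]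
    · rcases lt_or_gt_of_ne hmn with h | h
      · rw [hin, hdisj _ _ h, measureReal_empty]
      · rw [hin, Set.inter_comm, hdisj _ _ h, measureReal_empty]
  exact not_finite_iff_infinite.2 (inferInstance : Infinite ℕ) hli.finite

end MetricGraph

/-! ### Solution operators of coercive forms -/

namespace CompactSpectrum

section LaxMilgram

variable {W H : Type*} [NormedAddCommGroup W] [InnerProductSpace ℝ W] [CompleteSpace W]
  [NormedAddCommGroup H] [InnerProductSpace ℝ H] [CompleteSpace H]
  (ι : W →L[ℝ] H) {B : W →L[ℝ] W →L[ℝ] ℝ} (hB : IsCoercive B)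

/-- The bounded operator sending `f` to the solution `x` of `B x y = ⟪f, ι y⟫` for all `y`. -/
noncomputable def weakSolution : H →L[ℝ] W :=
  (hB.continuousLinearEquivOfBilin.symm : W →L[ℝ] W).comp (ContinuousLinearMap.adjoint ι)

/-- The solution operator of the variational problem `B x y = ⟪f, ι y⟫`, as an operator in `H`. -/
noncomputable def solutionOp : H →L[ℝ] H := ι.comp (weakSolution ι hB)

theorem weakSolution_spec (f : H) (y : W) : B (weakSolution ι hB f) y = inner ℝ f (ι y) := by
  rw [← hB.continuousLinearEquivOfBilin_apply]
  simp [weakSolution, ContinuousLinearMap.adjoint_inner_left]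

/-- The difference of two solutions is annihilated by the form, so coercivity makes it zero. -/
theorem eq_weakSolution {f : H} {x : W} (h : ∀ y, B x y = inner ℝ f (ι y)) :
    x = weakSolution ι hB f := by
  set y := weakSolution ι hB f with hy
  obtain ⟨C, hC, hco⟩ := id hB
  have h0 := hco (x - y)
  rw [map_sub B x y, sub_apply, h, hy, weakSolution_spec, sub_self, ← hy] at h0
  have h1 : ‖x - y‖ = 0 := by
    by_contra hne
    have : 0 < ‖x - y‖ := lt_of_le_of_ne (norm_nonneg _) (Ne.symm hne)
    have := mul_pos (mul_pos hC this) this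
    linarith
  exact sub_eq_zero.1 (norm_eq_zero.1 h1)

theorem isCompactOperator_solutionOp (hι : IsCompactOperator ι) :
    IsCompactOperator (solutionOp ι hB) :=
  hι.comp_clm (weakSolution ι hB)

theorem inner_solutionOp (f h : H) :
    inner ℝ f (solutionOp ι hB h) = B (weakSolution ι hB f) (weakSolution ι hB h) :=
  (weakSolution_spec ι hB f _).symm

theorem isSymmetric_solutionOp (hs : ∀ x y, B x y = B y x) : (solutionOp ι hB).IsSymmetric := by
  intro f h
  change inner ℝ (solutionOp ι hB f) h = inner ℝ f (solutionOp ι hB h)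
  rw [real_inner_comm, inner_solutionOp, inner_solutionOp, hs]

theorem inner_solutionOp_self_nonneg (f : H) : 0 ≤ inner ℝ f (solutionOp ι hB f) := by
  rw [inner_solutionOp]
  obtain ⟨C, hC, hco⟩ := hB
  exact le_trans (by positivity) (hco _)

/-- Inversion reverses the order of forms. With `x`, `y` the solutions for `B`, `B'`, expand `0 ≤ B
(x - c⁻¹ y) (x - c⁻¹ y)` and bound `B y y` by `c B' y y`. -/
theorem inner_solutionOp_le {B' : W →L[ℝ] W →L[ℝ] ℝ} (hB' : IsCoercive B')
    (hs : ∀ x y, B x y = B y x) {c : ℝ} (hc : 0 < c) (hle : ∀ x, B x x ≤ c * B' x x) (f : H) :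
    c⁻¹ * inner ℝ f (solutionOp ι hB' f) ≤ inner ℝ f (solutionOp ι hB f) := by
  rw [inner_solutionOp, inner_solutionOp]
  set x := weakSolution ι hB f with hx
  set y := weakSolution ι hB' f with hy
  -- Both sides equal `⟪f, ι y⟫`.
  have h1 : B x y = B' y y := by rw [hx, weakSolution_spec, hy, weakSolution_spec]
  have h2 : 0 ≤ B (x - c⁻¹ • y) (x - c⁻¹ • y) := by
    obtain ⟨C, hC, hco⟩ := hB
    exact le_trans (by positivity) (hco _)
  have h3 : B (x - c⁻¹ • y) (x - c⁻¹ • y) =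
      B x x - 2 * c⁻¹ * B' y y + c⁻¹ * (c⁻¹ * B y y) := by
    simp only [map_sub, map_smul, sub_apply, smul_apply,
      smul_eq_mul, hs y x, h1]
    ring
  have h4 : c⁻¹ * B y y ≤ B' y y := by
    rw [inv_mul_le_iff₀ hc]
    exact hle y
  have h5 := mul_le_mul_of_nonneg_left h4 (inv_nonneg.2 hc.le)
  linarith

end LaxMilgram

/-- From `p = μ T p` follows `⟪p, T p⟫ = μ ‖T p‖²`. The hypothesis expresses the lower bound `a` for
the inverse of `T` without mentioning that inverse. -/
theorem le_of_mem_invEigenspace {H : Type*} [NormedAddCommGroup H] [InnerProductSpace ℝ H]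
    {T : H →L[ℝ] H} {a : ℝ} (ha : ∀ f, a * ‖T f‖ ^ 2 ≤ inner ℝ f (T f)) {μ : ℝ} {p : H}
    (hp : p ∈ invEigenspace T μ) (h0 : p ≠ 0) : a ≤ μ := by
  rw [mem_invEigenspace] at hp
  have h1 : inner ℝ p (T p) = μ * ‖T p‖ ^ 2 := by
    conv_lhs => rw [hp]
    rw [map_smul, real_inner_smul_left, real_inner_smul_right]
    have h2 : T p = μ • T (T p) := by
      conv_lhs => rw [hp]
      rw [map_smul]
    rw [← real_inner_smul_right, ← h2, real_inner_self_eq_norm_sq]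
  have h2 : 0 < ‖T p‖ ^ 2 := by
    have : T p ≠ 0 := fun h => h0 (by rw [hp, h, smul_zero])
    positivity
  have h3 := ha p
  rw [h1] at h3
  exact le_of_mul_le_mul_right h3 h2

end CompactSpectrum

/-- A finite family of compact operators defines a compact operator into the `ℓ²` product. -/
theorem isCompactOperator_toLp {W E : Type*} [Fintype E] [NormedAddCommGroup W] [NormedSpace ℝ W]
    {X : E → Type*} [∀ e, NormedAddCommGroup (X e)] [∀ e, NormedSpace ℝ (X e)]
    (f : W → PiLp 2 X) (hf : ∀ e, IsCompactOperator fun x => f x e) : IsCompactOperator f := by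
  choose K hK hKn using hf
  refine ⟨WithLp.ofLp ⁻¹' Set.univ.pi K, ?_, ?_⟩
  · exact (PiLp.homeomorph 2 X).isCompact_preimage.2 (isCompact_univ_pi hK)
  · filter_upwards [(Filter.iInter_mem.2 hKn : (⋂ e, (fun x => f x e) ⁻¹' K e) ∈ nhds (0 : W))]
      with x hx e _
    exact Set.mem_iInter.1 hx e

/-! ### The Hilbert space `H¹(Γ)` and the energy form -/

namespace MetricGraph

variable {V E : Type*} (Γ : MetricGraph V E)

/-- Edgewise `H¹` functions, as pairs of initial values and weak derivatives. -/
noncomputable abbrev EdgewiseH1 : Type _ := WithLp 2 (EuclideanSpace ℝ E × Γ.L2)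

/-- The edgewise `H¹` function with initial values `x.fst` and weak derivative `x.snd`. -/
noncomputable def rep (x : Γ.EdgewiseH1) (e : E) (t : ℝ) : ℝ :=
  x.fst e + ∫ s in (0 : ℝ)..t, x.snd e s

/-- The embedding of edgewise `H¹` functions in `L²`. -/
noncomputable def embed : Γ.EdgewiseH1 →L[ℝ] Γ.L2 :=
  ((PiLp.continuousLinearEquiv 2 ℝ fun e : E => Lp ℝ 2 (edgeMeasure (Γ.len e))).symm :
    (∀ e : E, Lp ℝ 2 (edgeMeasure (Γ.len e))) →L[ℝ] Γ.L2).comp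
  (ContinuousLinearMap.pi fun e => (primitive (Γ.len e) (Γ.len_pos e).le).comp
    (((EuclideanSpace.proj e).comp (WithLp.fstL 2 ℝ _ _)).prod
      ((PiLp.proj 2 (fun e : E => Lp ℝ 2 (edgeMeasure (Γ.len e))) e).comp (WithLp.sndL 2 ℝ _ _))))

theorem embed_apply (x : Γ.EdgewiseH1) (e : E) :
    Γ.embed x e = primitive (Γ.len e) (Γ.len_pos e).le (x.fst e, x.snd e) := rfl

theorem isH1Rep_rep (x : Γ.EdgewiseH1) (e : E) :
    IsH1Rep (Γ.len e) (Γ.rep x e) (Γ.embed x e) (x.snd e) :=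
  isH1Rep_primitive (Γ.len_pos e).le _ _

theorem isCompactOperator_embed [Fintype E] : IsCompactOperator Γ.embed := by
  refine isCompactOperator_toLp _ fun e => ?_
  exact (isCompactOperator_primitive (Γ.len_pos e)).comp_clm
    (((EuclideanSpace.proj e).comp (WithLp.fstL 2 ℝ _ _)).prod
      ((PiLp.proj 2 (fun e : E => Lp ℝ 2 (edgeMeasure (Γ.len e))) e).comp (WithLp.sndL 2 ℝ _ _)))

/-- The values of an edgewise `H¹` function at the two ends of each edge. -/
noncomputable def endValues : Γ.EdgewiseH1 →L[ℝ] (E → ℝ) × (E → ℝ) :=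
  (ContinuousLinearMap.pi fun e => (EuclideanSpace.proj e).comp (WithLp.fstL 2 ℝ _ _)).prod
    (ContinuousLinearMap.pi fun e => (EuclideanSpace.proj e).comp (WithLp.fstL 2 ℝ _ _) +
      (integralTo (Γ.len e) (Γ.len e)).comp
        ((PiLp.proj 2 (fun e : E => Lp ℝ 2 (edgeMeasure (Γ.len e))) e).comp
          (WithLp.sndL 2 ℝ _ _)))

/-- The end values of the functions that take one common value at each vertex. -/
noncomputable def vertexValues : (V → ℝ) →ₗ[ℝ] (E → ℝ) × (E → ℝ) :=
  (LinearMap.funLeft ℝ ℝ Γ.src).prod (LinearMap.funLeft ℝ ℝ Γ.tgt)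

/-- The space `H¹(Γ)`. -/
noncomputable def energySpace : Submodule ℝ Γ.EdgewiseH1 :=
  (LinearMap.range Γ.vertexValues).comap Γ.endValues.toLinearMap

theorem mem_energySpace_iff {x : Γ.EdgewiseH1} :
    x ∈ Γ.energySpace ↔ Γ.VertexContinuous (Γ.rep x) := by
  have h : ∀ e, (Γ.endValues x).1 e = Γ.rep x e 0 ∧ (Γ.endValues x).2 e = Γ.rep x e (Γ.len e) := by
    intro e
    refine ⟨by simp [endValues, rep], ?_⟩
    rw [rep, ← integralTo_apply (Set.right_mem_Icc.2 (Γ.len_pos e).le)]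
    rfl
  constructor
  · rintro ⟨val, hval⟩
    refine ⟨val, fun e => ?_⟩
    rw [← (h e).1, ← (h e).2]
    change _ = (Γ.endValues x) at hval
    rw [← hval]
    exact ⟨rfl, rfl⟩
  · rintro ⟨val, hval⟩
    refine ⟨val, Prod.ext (funext fun e => ?_) (funext fun e => ?_)⟩
    · exact ((h e).1.trans (hval e).1).symm
    · exact ((h e).2.trans (hval e).2).symm

/-- The space `H¹(Γ)` as a Hilbert space. -/
def EnergySpace : Type _ := Γ.energySpace

noncomputable instance [Fintype E] : NormedAddCommGroup Γ.EnergySpace :=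
  inferInstanceAs (NormedAddCommGroup Γ.energySpace)

noncomputable instance [Fintype E] : InnerProductSpace ℝ Γ.EnergySpace :=
  inferInstanceAs (InnerProductSpace ℝ Γ.energySpace)

/-- Vertex continuity is the preimage, under the continuous end-value map, of a finite-dimensional
and so closed subspace. -/
instance [Fintype V] [Fintype E] : CompleteSpace Γ.EnergySpace := by
  have : IsClosed (Γ.energySpace : Set Γ.EdgewiseH1) :=
    (Submodule.closed_of_finiteDimensional (LinearMap.range Γ.vertexValues)).preimage
      Γ.endValues.continuous
  exact this.completeSpace_coe

/-- The inclusion of `H¹(Γ)` in the edgewise `H¹` functions. -/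
noncomputable def incl [Fintype E] : Γ.EnergySpace →L[ℝ] Γ.EdgewiseH1 := Γ.energySpace.subtypeL

theorem norm_incl [Fintype E] (x : Γ.EnergySpace) : ‖Γ.incl x‖ = ‖x‖ := rfl

theorem vertexContinuous_incl [Fintype E] (x : Γ.EnergySpace) :
    Γ.VertexContinuous (Γ.rep (Γ.incl x)) :=
  Γ.mem_energySpace_iff.1 (Subtype.property (p := fun x => x ∈ Γ.energySpace) x)

theorem exists_incl_eq [Fintype E] {x : Γ.EdgewiseH1} (hx : Γ.VertexContinuous (Γ.rep x)) :
    ∃ y : Γ.EnergySpace, Γ.incl y = x :=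
  ⟨(⟨x, Γ.mem_energySpace_iff.2 hx⟩ : Γ.energySpace), rfl⟩

/-- `M` is multiplication by `e^u`. -/
def IsMulExp (u : Γ.L2) (M : Γ.L2 →L[ℝ] Γ.L2) : Prop :=
  ∀ g e, ∀ᵐ t ∂(edgeMeasure (Γ.len e)), M g e t = Real.exp (u e t) * g e t

/-- A bounded `u` has bounded `e^u`, and Hölder's inequality makes multiplication `L^∞ × L² → L²`
continuous. -/
theorem exists_isMulExp {u : Γ.L2} (hu : ∀ e, MemLp (u e) ⊤ (edgeMeasure (Γ.len e))) :
    ∃ M, Γ.IsMulExp u M := by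
  have ha : ∀ e, MemLp (fun t => Real.exp (u e t)) ⊤ (edgeMeasure (Γ.len e)) := fun e => by
    refine memLp_top_of_bound
      (Real.continuous_exp.comp_aestronglyMeasurable (hu e).aestronglyMeasurable)
      (Real.exp (eLpNorm (u e) ⊤ (edgeMeasure (Γ.len e))).toReal) ?_
    have h1 := ae_le_eLpNormEssSup (f := u e) (μ := edgeMeasure (Γ.len e))
    filter_upwards [h1] with t ht
    rw [Real.norm_of_nonneg (Real.exp_pos _).le, Real.exp_le_exp]
    refine (le_abs_self _).trans ?_
    rw [← Real.norm_eq_abs, ← toReal_enorm, eLpNorm_exponent_top]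
    exact ENNReal.toReal_mono (by rw [← eLpNorm_exponent_top]; exact (hu e).2.ne) ht
  let m : ∀ e, Lp ℝ 2 (edgeMeasure (Γ.len e)) →L[ℝ] Lp ℝ 2 (edgeMeasure (Γ.len e)) := fun e =>
    (ContinuousLinearMap.mul ℝ ℝ).holderL (edgeMeasure (Γ.len e)) ⊤ 2 2 (ha e).toLp
  refine ⟨((PiLp.continuousLinearEquiv 2 ℝ fun e : E => Lp ℝ 2 (edgeMeasure (Γ.len e))).symm :
    (∀ e : E, Lp ℝ 2 (edgeMeasure (Γ.len e))) →L[ℝ] Γ.L2).comp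
    (ContinuousLinearMap.pi fun e => (m e).comp
      (PiLp.proj 2 (fun e : E => Lp ℝ 2 (edgeMeasure (Γ.len e))) e)), fun g e => ?_⟩
  filter_upwards [(ha e).coeFn_toLp, ContinuousLinearMap.coeFn_holder (r := 2)
    (ContinuousLinearMap.mul ℝ ℝ) (ha e).toLp (g e)] with t h1 h2
  rw [← h1]
  exact h2

theorem inner_le_inner_of_ae {ℓ : ℝ} {f₁ f₂ g : Lp ℝ 2 (edgeMeasure ℓ)}
    (h : ∀ᵐ t ∂(edgeMeasure ℓ), f₁ t * g t ≤ f₂ t * g t) : inner ℝ f₁ g ≤ inner ℝ f₂ g := by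
  rw [L2.inner_def, L2.inner_def]
  refine integral_mono_ae (L2.integrable_inner _ _) (L2.integrable_inner _ _) ?_
  filter_upwards [h] with t ht
  simpa [mul_comm] using ht

variable [Fintype E]

theorem IsMulExp.symm {u : Γ.L2} {M : Γ.L2 →L[ℝ] Γ.L2} (hM : Γ.IsMulExp u M) (g h : Γ.L2) :
    inner ℝ (M g) h = inner ℝ (M h) g := by
  rw [PiLp.inner_apply, PiLp.inner_apply]
  refine Finset.sum_congr rfl fun e _ => ?_
  rw [L2.inner_def, L2.inner_def]
  refine integral_congr_ae ?_
  filter_upwards [hM g e, hM h e] with t h1 h2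
  simp only [h1, h2, RCLike.inner_apply, conj_trivial]
  ring

theorem IsMulExp.inner_le {u₁ u₂ : Γ.L2} {M₁ M₂ : Γ.L2 →L[ℝ] Γ.L2} (h₁ : Γ.IsMulExp u₁ M₁)
    (h₂ : Γ.IsMulExp u₂ M₂) {δ : ℝ}
    (h : ∀ e, ∀ᵐ t ∂(edgeMeasure (Γ.len e)), u₁ e t ≤ u₂ e t + δ) (g : Γ.L2) :
    inner ℝ (M₁ g) g ≤ Real.exp δ * inner ℝ (M₂ g) g := by
  rw [← real_inner_smul_left, PiLp.inner_apply, PiLp.inner_apply]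
  refine Finset.sum_le_sum fun e _ => inner_le_inner_of_ae ?_
  rw [PiLp.smul_apply]
  filter_upwards [h₁ g e, h₂ g e, h e, Lp.coeFn_smul (Real.exp δ) (M₂ g e)] with t a b c d
  rw [d, Pi.smul_apply, a, b, smul_eq_mul, ← mul_assoc (Real.exp δ), ← Real.exp_add, mul_assoc,
    mul_assoc]
  refine mul_le_mul_of_nonneg_right (Real.exp_le_exp.2 ?_) (mul_self_nonneg _)
  linarith

theorem IsMulExp.le_inner {u : Γ.L2} {M : Γ.L2 →L[ℝ] Γ.L2} (hM : Γ.IsMulExp u M) {δ : ℝ}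
    (h : ∀ e, ∀ᵐ t ∂(edgeMeasure (Γ.len e)), -δ ≤ u e t) (g : Γ.L2) :
    Real.exp (-δ) * ‖g‖ ^ 2 ≤ inner ℝ (M g) g := by
  rw [← real_inner_self_eq_norm_sq, ← real_inner_smul_left, PiLp.inner_apply, PiLp.inner_apply]
  refine Finset.sum_le_sum fun e _ => inner_le_inner_of_ae ?_
  rw [PiLp.smul_apply]
  filter_upwards [hM g e, h e, Lp.coeFn_smul (Real.exp (-δ)) (g e)] with t a c d
  rw [d, Pi.smul_apply, a, smul_eq_mul, mul_assoc, mul_assoc]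
  exact mul_le_mul_of_nonneg_right (Real.exp_le_exp.2 c) (mul_self_nonneg _)

/-- The restriction of the embedding to `H¹(Γ)`. -/
noncomputable def embedEnergy : Γ.EnergySpace →L[ℝ] Γ.L2 := Γ.embed.comp Γ.incl

/-- The weak derivative on `H¹(Γ)`. -/
noncomputable def derivEnergy : Γ.EnergySpace →L[ℝ] Γ.L2 :=
  (WithLp.sndL 2 ℝ _ _).comp Γ.incl

/-- The energy form `κ² ⟪p, v⟫ + ⟪M p', v'⟫` on `H¹(Γ)`. -/
noncomputable def energyForm (κ : ℝ) (M : Γ.L2 →L[ℝ] Γ.L2) :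
    Γ.EnergySpace →L[ℝ] Γ.EnergySpace →L[ℝ] ℝ :=
  κ ^ 2 • ContinuousLinearMap.bilinearComp (innerSL ℝ : Γ.L2 →L[ℝ] Γ.L2 →L[ℝ] ℝ)
    Γ.embedEnergy Γ.embedEnergy +
  ContinuousLinearMap.bilinearComp (innerSL ℝ : Γ.L2 →L[ℝ] Γ.L2 →L[ℝ] ℝ)
    (M.comp Γ.derivEnergy) Γ.derivEnergy

theorem energyForm_apply (κ : ℝ) (M : Γ.L2 →L[ℝ] Γ.L2) (x y : Γ.EnergySpace) :
    Γ.energyForm κ M x y =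
      κ ^ 2 * inner ℝ (Γ.embed (Γ.incl x)) (Γ.embed (Γ.incl y)) + inner ℝ (M (Γ.incl x).snd)
        (Γ.incl y).snd := rfl

theorem energyForm_symm (κ : ℝ) {u : Γ.L2} {M : Γ.L2 →L[ℝ] Γ.L2} (hM : Γ.IsMulExp u M)
    (x y : Γ.EnergySpace) : Γ.energyForm κ M x y = Γ.energyForm κ M y x := by
  rw [energyForm_apply, energyForm_apply, real_inner_comm, hM.symm]

/-- This replaces a trace inequality. On the finite-dimensional space of edgewise constants the
embedding in `L²` is injective, hence bounded below; the constant part of `x` is `x` minus the part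
coming from its derivative. -/
theorem exists_norm_fst_le : ∃ K : ℝ, 0 ≤ K ∧ ∃ L : ℝ, 0 ≤ L ∧
    ∀ x : Γ.EdgewiseH1, ‖x.fst‖ ≤ K * (‖Γ.embed x‖ + L * ‖x.snd‖) := by
  let i₁ : EuclideanSpace ℝ E →L[ℝ] Γ.EdgewiseH1 :=
    ((WithLp.prodContinuousLinearEquiv 2 ℝ (EuclideanSpace ℝ E) Γ.L2).symm :
      EuclideanSpace ℝ E × Γ.L2 →L[ℝ] Γ.EdgewiseH1).comp (ContinuousLinearMap.inl ℝ _ _)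
  let i₂ : Γ.L2 →L[ℝ] Γ.EdgewiseH1 :=
    ((WithLp.prodContinuousLinearEquiv 2 ℝ (EuclideanSpace ℝ E) Γ.L2).symm :
      EuclideanSpace ℝ E × Γ.L2 →L[ℝ] Γ.EdgewiseH1).comp (ContinuousLinearMap.inr ℝ _ _)
  have hsum : ∀ x : Γ.EdgewiseH1, i₁ x.fst = x - i₂ x.snd := fun x => by
    refine (WithLp.ofLp_injective 2) (Prod.ext ?_ ?_) <;> simp [i₁, i₂]
  have hker : LinearMap.ker (Γ.embed.comp i₁).toLinearMap = ⊥ := by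
    rw [LinearMap.ker_eq_bot']
    intro c hc
    ext e
    have h1 := Γ.isH1Rep_rep (i₁ c) e
    have h2 : Γ.embed (i₁ c) e = 0 := by
      have : Γ.embed (i₁ c) = 0 := hc
      rw [this]; rfl
    rw [h2] at h1
    have h3 := (h1.eq_zero_of_zero (Γ.len_pos e)).1 0 (Set.left_mem_Icc.2 (Γ.len_pos e).le)
    simpa [rep, i₁] using h3
  obtain ⟨K, -, hK⟩ := LinearMap.exists_antilipschitzWith _ hker
  refine ⟨K, K.2, ‖Γ.embed.comp i₂‖, norm_nonneg _, fun x => ?_⟩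
  have h1 := hK.le_mul_dist x.fst 0
  rw [dist_zero_right, map_zero, dist_zero_right] at h1
  refine h1.trans (mul_le_mul_of_nonneg_left ?_ K.2)
  change ‖Γ.embed (i₁ x.fst)‖ ≤ _
  rw [hsum, map_sub]
  exact (norm_sub_le _ _).trans (by gcongr; exact (Γ.embed.comp i₂).le_opNorm _)

/-- The norm of `EnergySpace` measures initial values and derivative, whereas the form controls the
function and the derivative in `L²`; `exists_norm_fst_le` bridges the two. -/
theorem isCoercive_energyForm {κ : ℝ} (hκ : 0 < κ) {u : Γ.L2} {M : Γ.L2 →L[ℝ] Γ.L2}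
    (hM : Γ.IsMulExp u M) {δ : ℝ} (h : ∀ e, ∀ᵐ t ∂(edgeMeasure (Γ.len e)), -δ ≤ u e t) :
    IsCoercive (Γ.energyForm κ M) := by
  obtain ⟨K, hK, L, hL, hfst⟩ := Γ.exists_norm_fst_le
  set m := Real.exp (-δ) with hm
  have hm0 : 0 < m := Real.exp_pos _
  -- From `(a + L b)² ≤ 2 a² + 2 L² b²`: the first summand pays for `a²` out of `κ² a²`, the second
  -- for `b²` out of `q ≥ m b²`.
  set D := 2 * K ^ 2 / κ ^ 2 + (2 * K ^ 2 * L ^ 2 + 1) / m with hD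
  have hD0 : 0 < D := by positivity
  refine ⟨D⁻¹, inv_pos.2 hD0, fun x => ?_⟩
  rw [mul_assoc, inv_mul_le_iff₀ hD0, energyForm_apply, real_inner_self_eq_norm_sq]
  have h1 := hM.le_inner Γ h (Γ.incl x).snd
  have h2 : ‖x‖ * ‖x‖ = ‖(Γ.incl x).fst‖ ^ 2 + ‖(Γ.incl x).snd‖ ^ 2 := by
    rw [← pow_two, ← Γ.norm_incl, WithLp.prod_norm_sq_eq_of_L2]
  rw [h2]
  set a := ‖Γ.embed (Γ.incl x)‖
  set b := ‖(Γ.incl x).snd‖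
  set q := inner ℝ (M (Γ.incl x).snd) (Γ.incl x).snd
  have h3 : ‖(Γ.incl x).fst‖ ^ 2 ≤ 2 * K ^ 2 * a ^ 2 + 2 * K ^ 2 * L ^ 2 * b ^ 2 := by
    have h4 := pow_le_pow_left₀ (norm_nonneg _) (hfst (Γ.incl x)) 2
    refine h4.trans ?_
    nlinarith [mul_nonneg (sq_nonneg K) (sq_nonneg (a - L * b))]
  have hq : 0 ≤ q := le_trans (by positivity) h1
  have h5 : (2 * K ^ 2 / κ ^ 2) * (κ ^ 2 * a ^ 2) = 2 * K ^ 2 * a ^ 2 := by field_simp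
  have h6 : (2 * K ^ 2 * L ^ 2 + 1) * b ^ 2 ≤ ((2 * K ^ 2 * L ^ 2 + 1) / m) * q := by
    rw [div_mul_eq_mul_div, le_div_iff₀ hm0, mul_assoc, mul_comm (b ^ 2)]
    exact mul_le_mul_of_nonneg_left h1 (by positivity)
  have h7 : 0 ≤ (2 * K ^ 2 / κ ^ 2) * q := by positivity
  have h8 : 0 ≤ ((2 * K ^ 2 * L ^ 2 + 1) / m) * (κ ^ 2 * a ^ 2) := by positivity
  have h9 : D * (κ ^ 2 * a ^ 2 + q) = (2 * K ^ 2 / κ ^ 2) * (κ ^ 2 * a ^ 2) +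
      (2 * K ^ 2 / κ ^ 2) * q + ((2 * K ^ 2 * L ^ 2 + 1) / m) * (κ ^ 2 * a ^ 2) +
      ((2 * K ^ 2 * L ^ 2 + 1) / m) * q := by rw [hD]; ring
  rw [h9, h5]
  linarith

end MetricGraph

/-! ### Equivalence of the strong and the variational formulation -/

namespace MetricGraph

open CompactSpectrum

variable {V E : Type*} (Γ : MetricGraph V E)

open Classical in
theorem sum_boundary [Fintype V] [Fintype E] (Q : E → ℝ → ℝ) (val : V → ℝ) :
    ∑ e, (Q e (Γ.len e) * val (Γ.tgt e) - Q e 0 * val (Γ.src e)) =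
      -∑ v, val v * ((∑ e with Γ.src e = v, Q e 0) + (∑ e with Γ.tgt e = v, -Q e (Γ.len e))) := by
  have key : ∀ (g : E → V) (f : E → ℝ),
      ∑ v, val v * ∑ e with g e = v, f e = ∑ e, f e * val (g e) := fun g f => by
    rw [← Finset.sum_fiberwise Finset.univ g]
    refine Finset.sum_congr rfl fun v _ => ?_
    rw [Finset.mul_sum]
    refine Finset.sum_congr rfl fun e he => ?_
    rw [(Finset.mem_filter.1 he).2, mul_comm]
  simp only [mul_add, Finset.sum_add_distrib, key, Finset.sum_sub_distrib, neg_mul]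
  simp only [Finset.sum_neg_distrib]
  ring

/-- Green's formula on a metric graph. -/
theorem inner_add_inner_eq_sum_boundary [Fintype E] {q dq : Γ.L2} {Q : E → ℝ → ℝ}
    (hQ : ∀ e, IsH1Rep (Γ.len e) (Q e) (q e) (dq e)) {y : Γ.EdgewiseH1} {val : V → ℝ}
    (hy : ∀ e, Γ.rep y e 0 = val (Γ.src e) ∧ Γ.rep y e (Γ.len e) = val (Γ.tgt e)) :
    inner ℝ dq (Γ.embed y) + inner ℝ q y.snd =
      ∑ e, (Q e (Γ.len e) * val (Γ.tgt e) - Q e 0 * val (Γ.src e)) := by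
  rw [PiLp.inner_apply, PiLp.inner_apply, ← Finset.sum_add_distrib]
  refine Finset.sum_congr rfl fun e _ => ?_
  rw [(hQ e).inner_add_inner (Γ.len_pos e).le (Γ.isH1Rep_rep y e), (hy e).1, (hy e).2]

theorem exists_of_isH1Rep [Fintype E] {p dp : Γ.L2} {P : E → ℝ → ℝ}
    (hP : ∀ e, IsH1Rep (Γ.len e) (P e) (p e) (dp e)) (hc : Γ.VertexContinuous P) :
    ∃ x : Γ.EnergySpace, Γ.embed (Γ.incl x) = p ∧ (Γ.incl x).snd = dp := by
  let x : Γ.EdgewiseH1 := WithLp.toLp 2 (WithLp.toLp 2 fun e => P e 0, dp)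
  have hrep : ∀ e, ∀ t ∈ Set.Icc 0 (Γ.len e), Γ.rep x e t = P e t := fun e t ht =>
    ((hP e).2 t ht).symm
  obtain ⟨val, hval⟩ := hc
  obtain ⟨x', hx'⟩ := Γ.exists_incl_eq (x := x) ⟨val, fun e => by
    rw [hrep e _ (Set.left_mem_Icc.2 (Γ.len_pos e).le),
      hrep e _ (Set.right_mem_Icc.2 (Γ.len_pos e).le)]
    exact hval e⟩
  refine ⟨x', ?_, congrArg WithLp.snd hx'⟩
  rw [hx']
  ext1 e
  rw [embed_apply]
  exact ((hP e).eq_primitive (Γ.len_pos e).le).symm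

theorem integralTo_indicator {ℓ : ℝ} (hℓ : 0 ≤ ℓ) :
    integralTo ℓ ℓ (indicatorConstLp 2 (measurableSet_Ioc : MeasurableSet (Set.Ioc 0 ℓ))
      (measure_ne_top (edgeMeasure ℓ) _) (1 : ℝ)) = ℓ := by
  rw [integralTo, innerSL_apply_apply, L2.real_inner_indicatorConstLp_one_indicatorConstLp_one,
    Set.inter_self, measureReal_restrict_apply measurableSet_Ioc, Set.inter_self,
    Real.volume_real_Ioc_of_le hℓ, sub_zero]

/-- An element of `H¹(Γ)` with prescribed values at the vertices. -/
theorem exists_rep_eq [Fintype E] (val : V → ℝ) : ∃ y : Γ.EnergySpace, ∀ e,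
    Γ.rep (Γ.incl y) e 0 = val (Γ.src e) ∧ Γ.rep (Γ.incl y) e (Γ.len e) = val (Γ.tgt e) := by
  let y : Γ.EdgewiseH1 := WithLp.toLp 2 (WithLp.toLp 2 fun e => val (Γ.src e),
    WithLp.toLp 2 fun e => ((val (Γ.tgt e) - val (Γ.src e)) / Γ.len e) •
      indicatorConstLp 2 (measurableSet_Ioc : MeasurableSet (Set.Ioc 0 (Γ.len e)))
      (measure_ne_top (edgeMeasure (Γ.len e)) _) (1 : ℝ))
  have hy : ∀ e, Γ.rep y e 0 = val (Γ.src e) ∧ Γ.rep y e (Γ.len e) = val (Γ.tgt e) := fun e => by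
    have hℓ := Γ.len_pos e
    refine ⟨by simp [rep, y], ?_⟩
    rw [rep, ← integralTo_apply (Set.right_mem_Icc.2 hℓ.le)]
    change val (Γ.src e) + integralTo (Γ.len e) (Γ.len e)
      (((val (Γ.tgt e) - val (Γ.src e)) / Γ.len e) • indicatorConstLp 2 _ _ _) = _
    rw [map_smul, integralTo_indicator hℓ.le, smul_eq_mul]
    field_simp
    ring
  obtain ⟨y', hy'⟩ := Γ.exists_incl_eq ⟨val, hy⟩
  exact ⟨y', by rwa [hy']⟩

/-- A function that is orthogonal to all functions of mean zero is constant. -/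
theorem eq_smul_indicator_of_forall_inner_eq_zero {ℓ : ℝ} {r : Lp ℝ 2 (edgeMeasure ℓ)}
    (h : ∀ φ, integralTo ℓ ℓ φ = 0 → inner ℝ r φ = 0) :
    ∃ d : ℝ, d • indicatorConstLp 2 (measurableSet_Ioc : MeasurableSet (Set.Ioc 0 ℓ))
      (measure_ne_top (edgeMeasure ℓ) _) (1 : ℝ) = r := by
  rw [← Submodule.mem_span_singleton, ← Submodule.orthogonal_orthogonal (Submodule.span ℝ _),
    Submodule.mem_orthogonal']
  intro φ hφ
  exact h φ (Submodule.mem_orthogonal_singleton_iff_inner_right.1 hφ)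

theorem primitive_const {ℓ : ℝ} (hℓ : 0 ≤ ℓ) (d : ℝ) :
    primitive ℓ hℓ (d, 0) =
      d • indicatorConstLp 2 (measurableSet_Ioc : MeasurableSet (Set.Ioc 0 ℓ))
        (measure_ne_top (edgeMeasure ℓ) _) (1 : ℝ) := by
  refine Lp.ext ?_
  filter_upwards [coeFn_primitive hℓ (d, 0), indicatorConstLp_coeFn (p := 2) (c := (1 : ℝ))
      (hs := (measurableSet_Ioc : MeasurableSet (Set.Ioc 0 ℓ)))
      (hμs := measure_ne_top (edgeMeasure ℓ) _),
    Lp.coeFn_smul d (indicatorConstLp 2 (measurableSet_Ioc : MeasurableSet (Set.Ioc 0 ℓ))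
        (measure_ne_top (edgeMeasure ℓ) _) (1 : ℝ)),
    ae_restrict_mem measurableSet_Ioc] with t h1 h2 h3 ht
  rw [h1, h3, Pi.smul_apply, h2, Set.indicator_of_mem ht,
    ← integralTo_apply (Set.Ioc_subset_Icc_self ht), map_zero]
  simp

theorem not_finiteDimensional_L2 [Nonempty E] : ¬ FiniteDimensional ℝ Γ.L2 := by
  classical
  intro hfin
  obtain ⟨e⟩ := (inferInstance : Nonempty E)
  refine not_finiteDimensional_edge (Γ.len_pos e) ?_
  exact FiniteDimensional.of_surjective
    (PiLp.proj 2 (𝕜 := ℝ) (fun e : E => Lp ℝ 2 (edgeMeasure (Γ.len e))) e).toLinearMap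
    fun φ => ⟨PiLp.single 2 e φ, by simp⟩

variable [Fintype V] [Fintype E]

/-- The graph of `L_u` is the inverse of the solution operator of the energy form. -/
theorem mem_ellipticGraph_iff {κ : ℝ} {u : Γ.L2} {M : Γ.L2 →L[ℝ] Γ.L2} (hM : Γ.IsMulExp u M)
    (hB : IsCoercive (Γ.energyForm κ M)) {p f : Γ.L2} :
    (p, f) ∈ Γ.ellipticGraph κ u ↔ p = solutionOp Γ.embedEnergy hB f := by
  constructor
  · rintro ⟨dp, q, dq, P, Q, hP, hc, hq, hQ, hK, hf⟩
    obtain ⟨x, rfl, rfl⟩ := Γ.exists_of_isH1Rep hP hc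
    have hqM : q = M (Γ.incl x).snd := by
      ext1 e
      refine Lp.ext ?_
      filter_upwards [hq e, hM (Γ.incl x).snd e] with t h1 h2
      rw [h1, h2]
    -- In Green's formula the boundary terms, grouped by vertex, vanish by the Kirchhoff condition.
    have hsol : x = weakSolution Γ.embedEnergy hB f := by
      refine eq_weakSolution _ hB fun y => ?_
      obtain ⟨val, hval⟩ := Γ.vertexContinuous_incl y
      have hG := Γ.inner_add_inner_eq_sum_boundary hQ hval
      rw [Γ.sum_boundary, Finset.sum_eq_zero (fun v _ => by rw [hK v, mul_zero]), neg_zero] at hG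
      rw [energyForm_apply, ← hqM]
      simp only at hf
      change _ = inner ℝ f (Γ.embed (Γ.incl y))
      rw [hf, inner_sub_left, real_inner_smul_left]
      linarith
    exact congrArg Γ.embedEnergy hsol
  · rintro rfl
    set x := weakSolution Γ.embedEnergy hB f with hx
    have hspec : ∀ y : Γ.EnergySpace, κ ^ 2 * inner ℝ (Γ.embed (Γ.incl x)) (Γ.embed (Γ.incl y)) +
        inner ℝ (M (Γ.incl x).snd) (Γ.incl y).snd = inner ℝ f (Γ.embed (Γ.incl y)) :=
      weakSolution_spec Γ.embedEnergy hB f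
    set q := M (Γ.incl x).snd with hq
    set h : Γ.L2 := κ ^ 2 • Γ.embed (Γ.incl x) - f with hh
    have hspec' : ∀ y : Γ.EnergySpace,
        inner ℝ h (Γ.embed (Γ.incl y)) + inner ℝ q (Γ.incl y).snd = 0 := fun y => by
      rw [hh, inner_sub_left, real_inner_smul_left]
      linarith [hspec y]
    -- Regularity of the flux (du Bois-Reymond): testing with functions supported on the edge `e`
    -- and zero at both ends shows that `q e` minus a primitive of `h e` is orthogonal to all
    -- mean-zero functions, hence constant.
    have hQ : ∀ e, ∃ d : ℝ, q e = primitive (Γ.len e) (Γ.len_pos e).le (d, h e) := by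
      classical
      intro e
      have hℓ := Γ.len_pos e
      obtain ⟨d, hd⟩ := eq_smul_indicator_of_forall_inner_eq_zero
        (r := q e - primitive (Γ.len e) hℓ.le (0, h e)) (fun φ hφ => by
        let y : Γ.EdgewiseH1 := WithLp.toLp 2 (0, PiLp.single 2 e φ)
        have hsnd : ∀ e', e' ≠ e → y.snd e' = 0 := fun e' he' => by
          simp [y, he']
        have hsnd' : y.snd e = φ := by simp [y]
        have hend : ∀ e', Γ.rep y e' 0 = 0 ∧ Γ.rep y e' (Γ.len e') = 0 := fun e' => by
          have h0 : Γ.rep y e' 0 = 0 := by simp [rep, y]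
          refine ⟨h0, ?_⟩
          rw [rep, ← integralTo_apply (Set.right_mem_Icc.2 (Γ.len_pos e').le)]
          have hf0 : y.fst e' = 0 := by simp [y]
          rw [hf0, zero_add]
          by_cases he' : e' = e
          · subst he'
            rw [hsnd', hφ]
          · rw [hsnd e' he', map_zero]
        obtain ⟨y', hy'⟩ := Γ.exists_incl_eq (x := y) ⟨fun _ => 0, hend⟩
        have h1 := hspec' y'
        rw [hy', PiLp.inner_apply, PiLp.inner_apply, ← Finset.sum_add_distrib,
          Finset.sum_eq_single e (fun e' _ he' => by
            rw [embed_apply, hsnd e' he', show y.fst e' = 0 by simp [y],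
              show ((0 : ℝ), (0 : Lp ℝ 2 (edgeMeasure (Γ.len e')))) = 0 from rfl, map_zero,
              inner_zero_right, inner_zero_right, add_zero])
            (fun he' => absurd (Finset.mem_univ e) he')] at h1
        have h2 := (isH1Rep_primitive hℓ.le 0 (h e)).inner_add_inner hℓ.le (Γ.isH1Rep_rep y e)
        rw [(hend e).1, (hend e).2, mul_zero, mul_zero, sub_zero, hsnd'] at h2
        rw [hsnd'] at h1
        rw [inner_sub_left]
        linarith)
      refine ⟨d, ?_⟩
      rw [← primitive_const hℓ.le] at hd
      rw [sub_eq_iff_eq_add.1 hd.symm, ← map_add]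
      simp
    have hQrep : ∀ e, ∃ Q, IsH1Rep (Γ.len e) Q (q e) (h e) := fun e => by
      obtain ⟨d, hd⟩ := hQ e
      rw [hd]
      exact ⟨_, isH1Rep_primitive (Γ.len_pos e).le _ _⟩
    choose Q hQrep using hQrep
    refine ⟨(Γ.incl x).snd, q, h, Γ.rep (Γ.incl x), _, Γ.isH1Rep_rep (Γ.incl x),
      Γ.vertexContinuous_incl x, hM _, hQrep, fun v => ?_, ?_⟩
    · classical
      -- A test function equal to `1` at `v` and `0` at the other vertices isolates the Kirchhoff
      -- sum at `v`.
      obtain ⟨y, hval⟩ := Γ.exists_rep_eq (Pi.single v 1)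
      have hG := Γ.inner_add_inner_eq_sum_boundary hQrep hval
      rw [hspec' y, Γ.sum_boundary, Finset.sum_eq_single v
        (fun w _ hw => by rw [Pi.single_eq_of_ne hw, zero_mul])
        (fun hv => absurd (Finset.mem_univ v) hv), Pi.single_eq_same, one_mul] at hG
      linarith
    · change f = κ ^ 2 • Γ.embed (Γ.incl x) - h
      rw [hh, sub_sub_cancel]

theorem isEigenvalueSeq_iff {κ : ℝ} {u : Γ.L2} {M : Γ.L2 →L[ℝ] Γ.L2} (hM : Γ.IsMulExp u M)
    (hB : IsCoercive (Γ.energyForm κ M)) {lam : ℕ → ℝ} :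
    Γ.IsEigenvalueSeq κ u lam ↔ IsListing (solutionOp Γ.embedEnergy hB) lam := by
  have h : ∀ μ, Γ.eigenspace κ u μ = invEigenspace (solutionOp Γ.embedEnergy hB) μ := fun μ => by
    ext p
    rw [mem_invEigenspace, ← map_smul, ← Γ.mem_ellipticGraph_iff hM hB]
    rfl
  refine and_congr Iff.rfl (forall_congr' fun μ => ?_)
  rw [h μ]

/-- If `p = 0`, then uniqueness of weak derivatives makes `p'`, the flux and its derivative vanish
in turn, so `f = κ² p - q' = 0`. -/
theorem eq_zero_of_solutionOp_eq_zero {κ : ℝ} {u : Γ.L2} {M : Γ.L2 →L[ℝ] Γ.L2}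
    (hM : Γ.IsMulExp u M) (hB : IsCoercive (Γ.energyForm κ M)) (f : Γ.L2)
    (hf : solutionOp Γ.embedEnergy hB f = 0) : f = 0 := by
  obtain ⟨dp, q, dq, P, Q, hP, -, hq, hQ, -, hf⟩ := (Γ.mem_ellipticGraph_iff hM hB).2 hf.symm
  have hdq : dq = 0 := by
    ext1 e
    have h1 : dp e = 0 := ((hP e).eq_zero_of_zero (Γ.len_pos e)).2
    have h2 : q e = 0 := by
      rw [Lp.eq_zero_iff_ae_eq_zero]
      filter_upwards [hq e, (Lp.eq_zero_iff_ae_eq_zero).1 h1] with t h3 h4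
      rw [h3, h4]
      simp
    have h3 := hQ e
    rw [h2] at h3
    exact (h3.eq_zero_of_zero (Γ.len_pos e)).2
  simpa [hdq] using hf

end MetricGraph

/-! ### Bounded coefficients and comparison of eigenvalues -/

namespace MetricGraph

open CompactSpectrum

variable {V E : Type*} (Γ : MetricGraph V E)

theorem IsH1.memLp_top {p dp : Γ.L2} (h : Γ.IsH1 p dp) (e : E) :
    MemLp (p e) ⊤ (edgeMeasure (Γ.len e)) := by
  obtain ⟨P, hP, -⟩ := h
  refine memLp_top_of_bound (Lp.aestronglyMeasurable _) (|P e 0| + √(Γ.len e) * ‖dp e‖) ?_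
  filter_upwards [(hP e).1, ae_restrict_mem measurableSet_Ioc] with t h1 ht
  rw [← h1, (hP e).2 t (Set.Ioc_subset_Icc_self ht)]
  exact abs_primitive_le _ _ (Set.Ioc_subset_Icc_self ht)

/-- One splitting `u = v + w` suffices, since both summands are in `H¹`. Without any splitting the
`K`-functional is the infimum of the empty set, namely `⊤`, and the integral diverges. -/
theorem MemHs.memLp_top [Fintype E] {s : ℝ} {u : Γ.L2} (h : Γ.MemHs s u) (e : E) :
    MemLp (u e) ⊤ (edgeMeasure (Γ.len e)) := by
  by_cases hex : ∃ v dv w dw ddw : Γ.L2, u = v + w ∧ Γ.IsH1 v dv ∧ Γ.IsH2C w dw ddw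
  · obtain ⟨v, dv, w, dw, ddw, rfl, hv, hw⟩ := hex
    exact ((hv.memLp_top Γ e).add (hw.1.memLp_top Γ e)).ae_eq (Lp.coeFn_add _ _).symm
  · exfalso
    have hK : ∀ t, Γ.kFunctionalSq t u = ⊤ := fun t => by
      rw [kFunctionalSq, sInf_eq_top]
      rintro k ⟨v, dv, w, dw, ddw, h1, h2, h3, -⟩
      exact absurd ⟨v, dv, w, dw, ddw, h1, h2, h3⟩ hex
    have hI : ∫⁻ t in Set.Ioi (0 : ℝ), ENNReal.ofReal (t ^ (-2 * (s - 1) - 1)) *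
        Γ.kFunctionalSq t u = ∫⁻ _ in Set.Ioi (0 : ℝ), ⊤ := by
      refine setLIntegral_congr_fun measurableSet_Ioi fun t ht => ?_
      simp only [hK]
      exact ENNReal.mul_top (ENNReal.ofReal_pos.2 (Real.rpow_pos_of_pos ht _)).ne'
    rw [MemHs, hI] at h
    simp at h

/-- Boundedness on every edge is essential: `normLinfty` would take the junk value `0` at an
infinite supremum. -/
theorem ae_abs_le_normLinfty [Fintype E] {u : Γ.L2}
    (hu : ∀ e, MemLp (u e) ⊤ (edgeMeasure (Γ.len e))) (e : E) :
    ∀ᵐ t ∂(edgeMeasure (Γ.len e)), |u e t| ≤ Γ.normLinfty u := by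
  have hlt : (⨆ e, eLpNorm (u e) ⊤ (edgeMeasure (Γ.len e))) ≠ ⊤ := by
    refine ne_top_of_le_ne_top (ENNReal.sum_lt_top.2 fun e _ => (hu e).2 :
      ∑ e, eLpNorm (u e) ⊤ (edgeMeasure (Γ.len e)) < ⊤).ne (iSup_le fun e => ?_)
    exact Finset.single_le_sum (f := fun e => eLpNorm (u e) ⊤ (edgeMeasure (Γ.len e)))
      (fun _ _ => zero_le) (Finset.mem_univ e)
  filter_upwards [ae_le_eLpNormEssSup (f := u e) (μ := edgeMeasure (Γ.len e))] with t ht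
  rw [← Real.norm_eq_abs, ← toReal_enorm]
  refine ENNReal.toReal_mono hlt (ht.trans ?_)
  rw [← eLpNorm_exponent_top]
  exact le_iSup (fun e => eLpNorm (u e) ⊤ (edgeMeasure (Γ.len e))) e

/-- The data of `L_u` for a bounded `u`: multiplication by `e^u`, and coercivity. -/
theorem exists_isMulExp_isCoercive [Fintype V] [Fintype E] {κ : ℝ} (hκ : 0 < κ) {u : Γ.L2}
    (hu : ∀ e, MemLp (u e) ⊤ (edgeMeasure (Γ.len e))) :
    ∃ M, Γ.IsMulExp u M ∧ IsCoercive (Γ.energyForm κ M) := by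
  obtain ⟨M, hM⟩ := Γ.exists_isMulExp hu
  refine ⟨M, hM, Γ.isCoercive_energyForm hκ hM (δ := Γ.normLinfty u) fun e => ?_⟩
  filter_upwards [Γ.ae_abs_le_normLinfty hu e] with t ht
  exact (abs_le.1 ht).1

theorem ae_le_add_normLinfty_sub [Fintype E] {u₁ u₂ : Γ.L2}
    (hu₁ : ∀ e, MemLp (u₁ e) ⊤ (edgeMeasure (Γ.len e)))
    (hu₂ : ∀ e, MemLp (u₂ e) ⊤ (edgeMeasure (Γ.len e))) (e : E) :
    ∀ᵐ t ∂(edgeMeasure (Γ.len e)), u₁ e t ≤ u₂ e t + Γ.normLinfty (u₁ - u₂) ∧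
      u₂ e t ≤ u₁ e t + Γ.normLinfty (u₁ - u₂) := by
  have hu : ∀ e, MemLp ((u₁ - u₂) e) ⊤ (edgeMeasure (Γ.len e)) := fun e =>
    ((hu₁ e).sub (hu₂ e)).ae_eq (Lp.coeFn_sub _ _).symm
  filter_upwards [Γ.ae_abs_le_normLinfty hu e, Lp.coeFn_sub (u₁ e) (u₂ e)] with t h1 h2
  rw [PiLp.sub_apply, h2, Pi.sub_apply, abs_le] at h1
  constructor <;> linarith [h1.1, h1.2]

theorem isCompactOperator_embedEnergy [Fintype E] : IsCompactOperator Γ.embedEnergy :=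
  Γ.isCompactOperator_embed.comp_clm Γ.incl

variable [Fintype V] [Fintype E]

theorem exists_isEigenvalueSeq [Nonempty E] {κ : ℝ} (hκ : 0 < κ) {u : Γ.L2}
    (hu : ∀ e, MemLp (u e) ⊤ (edgeMeasure (Γ.len e))) :
    ∃ lam, Γ.IsEigenvalueSeq κ u lam := by
  obtain ⟨M, hM, hB⟩ := Γ.exists_isMulExp_isCoercive hκ hu
  obtain ⟨lam, hlam⟩ := exists_isListing
    (isCompactOperator_solutionOp _ hB Γ.isCompactOperator_embedEnergy)
    (isSymmetric_solutionOp _ hB (Γ.energyForm_symm κ hM)) (inner_solutionOp_self_nonneg _ hB)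
    (Γ.eq_zero_of_solutionOp_eq_zero hM hB) Γ.not_finiteDimensional_L2
  exact ⟨lam, (Γ.isEigenvalueSeq_iff hM hB).2 hlam⟩

/-- The eigenvalues of `L_u` are at least `κ²`, and they are multiplicatively Lipschitz in `u`. -/
theorem IsEigenvalueSeq.le_and_le {κ : ℝ} (hκ : 0 < κ) {u₁ u₂ : Γ.L2}
    (hu₁ : ∀ e, MemLp (u₁ e) ⊤ (edgeMeasure (Γ.len e)))
    (hu₂ : ∀ e, MemLp (u₂ e) ⊤ (edgeMeasure (Γ.len e))) {lam₁ lam₂ : ℕ → ℝ}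
    (h₁ : Γ.IsEigenvalueSeq κ u₁ lam₁) (h₂ : Γ.IsEigenvalueSeq κ u₂ lam₂) {δ : ℝ} (hδ : 0 ≤ δ)
    (hle : ∀ e, ∀ᵐ t ∂(edgeMeasure (Γ.len e)), u₁ e t ≤ u₂ e t + δ) (j : ℕ) :
    κ ^ 2 ≤ lam₁ j ∧ lam₁ j ≤ Real.exp δ * lam₂ j := by
  obtain ⟨M₁, hM₁, hB₁⟩ := Γ.exists_isMulExp_isCoercive hκ hu₁
  obtain ⟨M₂, hM₂, hB₂⟩ := Γ.exists_isMulExp_isCoercive hκ hu₂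
  rw [Γ.isEigenvalueSeq_iff hM₁ hB₁] at h₁
  rw [Γ.isEigenvalueSeq_iff hM₂ hB₂] at h₂
  have hs₁ := isSymmetric_solutionOp Γ.embedEnergy hB₁ (Γ.energyForm_symm κ hM₁)
  have hs₂ := isSymmetric_solutionOp Γ.embedEnergy hB₂ (Γ.energyForm_symm κ hM₂)
  obtain ⟨b₁, hb₁⟩ := h₁.exists_hilbertBasis
    (isCompactOperator_solutionOp _ hB₁ Γ.isCompactOperator_embedEnergy) hs₁
    (Γ.eq_zero_of_solutionOp_eq_zero hM₁ hB₁)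
  obtain ⟨b₂, hb₂⟩ := h₂.exists_hilbertBasis
    (isCompactOperator_solutionOp _ hB₂ Γ.isCompactOperator_embedEnergy) hs₂
    (Γ.eq_zero_of_solutionOp_eq_zero hM₂ hB₂)
  have hpos₁ : ∀ j, 0 < lam₁ j := fun j => pos_of_mem_invEigenspace
    (inner_solutionOp_self_nonneg _ hB₁) (mem_invEigenspace.2 (hb₁ j)) (b₁.orthonormal.ne_zero j)
  have hpos₂ : ∀ j, 0 < lam₂ j := fun j => pos_of_mem_invEigenspace
    (inner_solutionOp_self_nonneg _ hB₂) (mem_invEigenspace.2 (hb₂ j)) (b₂.orthonormal.ne_zero j)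
  have hM₁0 : ∀ g, 0 ≤ inner ℝ (M₁ g) g := fun g => by
    refine le_trans (by positivity) (hM₁.le_inner Γ (δ := Γ.normLinfty u₁) (fun e => ?_) g)
    filter_upwards [Γ.ae_abs_le_normLinfty hu₁ e] with t ht
    exact (abs_le.1 ht).1
  refine ⟨le_of_mem_invEigenspace (fun f => ?_) (mem_invEigenspace.2 (hb₁ j))
    (b₁.orthonormal.ne_zero j), ?_⟩
  -- With `x` the weak solution for `f`, `⟪f, T f⟫` is the energy of `x`, at least `κ² ‖T f‖²` as
  -- the derivative term is nonnegative.
  · rw [inner_solutionOp, energyForm_apply, real_inner_self_eq_norm_sq]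
    exact le_add_of_nonneg_right (hM₁0 _)
  · have h := le_of_quadraticForm_le hs₁ hs₂ h₁.1 h₂.1 hpos₁ hpos₂ b₁ b₂ hb₁ hb₂
      (inv_nonneg.2 (Real.exp_pos δ).le)
      (inner_solutionOp_le Γ.embedEnergy hB₁ hB₂ (Γ.energyForm_symm κ hM₁) (Real.exp_pos δ)
        fun x => ?_) j
    · rwa [inv_mul_le_iff₀ (Real.exp_pos δ)] at h
    · rw [energyForm_apply, energyForm_apply, real_inner_self_eq_norm_sq, mul_add]
      -- The zero-order term does not depend on `u`; it is compared through `1 ≤ e^δ`, which needs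
      -- `δ ≥ 0`.
      refine add_le_add (le_mul_of_one_le_left (by positivity) (Real.one_le_exp hδ)) ?_
      exact hM₁.inner_le Γ hM₂ hle _

end MetricGraph

/-! ### From eigenvalue ratios to differences of negative powers -/

/-- The ratio bound gives `y^{-s} ≥ e^{-δs} x^{-s}`, so the difference is at most `(1 - e^{-δs})
x^{-s} ≤ δ s a^{-s}`. -/
theorem rpow_neg_sub_rpow_neg_le {a x y s δ : ℝ} (ha : 0 < a) (hs : 0 ≤ s) (hδ : 0 ≤ δ)
    (hx : a ≤ x) (hy : a ≤ y) (h : y ≤ Real.exp δ * x) : x ^ (-s) - y ^ (-s) ≤ a ^ (-s) * s * δ := by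
  have hx0 := ha.trans_le hx
  have hy0 := ha.trans_le hy
  have h1 : x ^ (-s) * Real.exp (-(δ * s)) ≤ y ^ (-s) := by
    have := Real.rpow_le_rpow_of_nonpos hy0 h (neg_nonpos.2 hs)
    rwa [Real.mul_rpow (Real.exp_pos δ).le hx0.le, ← Real.exp_mul, mul_neg, mul_comm] at this
  have h2 : 1 - δ * s ≤ Real.exp (-(δ * s)) := by
    linarith [Real.add_one_le_exp (-(δ * s))]
  have h3 : x ^ (-s) ≤ a ^ (-s) := Real.rpow_le_rpow_of_nonpos ha hx (neg_nonpos.2 hs)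
  have h4 : 0 ≤ x ^ (-s) := Real.rpow_nonneg hx0.le _
  have h5 := mul_le_mul_of_nonneg_left h2 h4
  have h6 := mul_le_mul_of_nonneg_right h3 (mul_nonneg hs hδ)
  linarith

theorem mainTheorem6 {V E : Type*} [Fintype V] [Fintype E] [Nonempty E] (Γ : MetricGraph V E)
    (κ : ℝ) (hκ : 0 < κ) (s : ℝ) (hs : 0 ≤ s) :
    (∀ u : Γ.L2, Γ.MemHs (3 / 2) u → ∃ lam : ℕ → ℝ, Γ.IsEigenvalueSeq κ u lam) ∧
    ∃ C : ℝ, 0 < C ∧ ∀ u₁ u₂ : Γ.L2, Γ.MemHs (3 / 2) u₁ → Γ.MemHs (3 / 2) u₂ →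
      ∀ lam₁ lam₂ : ℕ → ℝ, Γ.IsEigenvalueSeq κ u₁ lam₁ → Γ.IsEigenvalueSeq κ u₂ lam₂ →
        ∀ j : ℕ, |lam₁ j ^ (-s) - lam₂ j ^ (-s)| ≤
          C * Real.exp ((s + 2) * max (Γ.normLinfty u₁) (Γ.normLinfty u₂)) *
            Γ.normLinfty (u₁ - u₂) := by
  -- The summand `1` in the constant only keeps it positive when `s = 0`.
  refine ⟨fun u hu => Γ.exists_isEigenvalueSeq hκ (hu.memLp_top Γ),
    (κ ^ 2) ^ (-s) * s + 1, by positivity, fun u₁ u₂ hu₁ hu₂ lam₁ lam₂ h₁ h₂ j => ?_⟩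
  have m₁ := hu₁.memLp_top Γ
  have m₂ := hu₂.memLp_top Γ
  set δ := Γ.normLinfty (u₁ - u₂) with hδ
  have hδ0 : 0 ≤ δ := ENNReal.toReal_nonneg
  have hae := Γ.ae_le_add_normLinfty_sub m₁ m₂
  obtain ⟨l₁, le₁⟩ := h₁.le_and_le Γ hκ m₁ m₂ h₂ hδ0 (fun e => (hae e).mono fun _ h => h.1) j
  obtain ⟨l₂, le₂⟩ := h₂.le_and_le Γ hκ m₂ m₁ h₁ hδ0 (fun e => (hae e).mono fun _ h => h.2) j
  have hκ2 : 0 < κ ^ 2 := by positivity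
  have hmax : 0 ≤ max (Γ.normLinfty u₁) (Γ.normLinfty u₂) :=
    le_max_of_le_left ENNReal.toReal_nonneg
  have hexp : 1 ≤ Real.exp ((s + 2) * max (Γ.normLinfty u₁) (Γ.normLinfty u₂)) :=
    Real.one_le_exp (by positivity)
  have hA : 0 ≤ (κ ^ 2) ^ (-s) * s := by positivity
  calc |lam₁ j ^ (-s) - lam₂ j ^ (-s)| ≤ (κ ^ 2) ^ (-s) * s * δ :=
        abs_sub_le_iff.2 ⟨rpow_neg_sub_rpow_neg_le hκ2 hs hδ0 l₁ l₂ le₂,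
          rpow_neg_sub_rpow_neg_le hκ2 hs hδ0 l₂ l₁ le₁⟩
    _ ≤ ((κ ^ 2) ^ (-s) * s + 1) * 1 * δ := by
        rw [mul_one]
        exact mul_le_mul_of_nonneg_right (by linarith) hδ0
    _ ≤ _ := by gcongr
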